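/- **Lemma 3.3.** Let $\widetilde V$ be a commutative $\mathbb C$-algebra with a $\mathbb C$-linear derivation $\partial_X$ whose only constants are the complex numbers, i.e. $\ker\partial_X=\mathbb C\cdot 1$, and let $V\subseteq\widetilde V$ be a $\mathbb C$-subalgebra closed under $\partial_X$ with $V\subseteq\partial_X(\widetilde V)$ (for instance rings of functions of $X$). Put $\mathbf t=(t_0=X,t_1,t_2,\dots)$ and $\mathcal S=\widetilde V((\epsilon))[[t_1,t_2,\dots]]$, with the derivations $\partial/\partial t_k$, where $\partial/\partial t_0=\partial_X$ acts on coefficients. For $q,r\in\mathcal S$ let $$\mathcal L(\xi)=\epsilon\,\partial_X+\begin{pmatrix}-\xi&-q\\ r&\xi\end{pmatrix},$$ let $R(\xi)$ be its basic matrix resolvent, that is, the unique $2\times2$ matrix with $R(\xi)-\mathrm{diag}(2,0)\in \mathrm{Mat}(2,\mathcal S[[\xi^{-1}]]\xi^{-1})$, $[\mathcal L(\xi),R(\xi)]=0$, $\operatorname{tr}R(\xi)=2$ and $\det R(\xi)=0$, and let $(\cdot)_+$ denote the part polynomial in $\xi$. Let $q,r\in V((\epsilon))[[t_1,t_2,\dots]]$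 be a solution of the AKNS hierarchy $$\frac{\partial\mathcal L(\xi)}{\partial t_j}=2^j\epsilon^{-1}\bigl[(\xi^{j+1}R(\xi))_+,\mathcal L(\xi)\bigr],\qquad j\ge0,$$ such that $q$ is not a zero divisor in $\mathcal S$ and $q_X/q\in\mathcal S$ (i.e. $q$ divides $q_X$ in $\mathcal S$). Put $\alpha=\epsilon^{-1}\sum_{k\ge0}2^kt_k\xi^{k+1}$, where $e^{\pm\alpha}$ are formal exponentials. A *wave function of type A* is an element $\psi_A=\phi_A e^{\alpha}$ with $\phi_A\in 1+\mathcal S[[\xi^{-1}]]\xi^{-1}$, and a *wave function of type B* is an element $\psi_B=\phi_B\,q\,e^{-\alpha}$ with $\phi_B\in1+\mathcal S[[\xi^{-1}]]\xi^{-1}$, such that for $\psi=\psi_A$, respectively $\psi=\psi_B$, the quotient $(\epsilon\psi_X-\xi\psi)/q$ exists (with coefficients in $\mathcal S((\xi^{-1}))$) and the vector $\Psi=\bigl(\psi,\ (\epsilon\psi_X-\xi\psi)/q\bigr)^T$ satisfies $$\frac{\partial\Psi}{\partial t_k}=\epsilon^{-1}2^k\Bigl(\bigl(\xi^{k+1}R(\xi)\bigr)_+-\xi^{k+1}I\Bigr)\Psi,\qquad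 k\ge0.$$ Wave functions $\psi_A,\psi_B$ of types A and B *form a pair* if $$d:=\epsilon\,\frac{\psi_A\,\psi_{B,X}-\psi_{A,X}\,\psi_B}{q}=-2\xi .$$ Then there exist wave functions $\psi_A,\psi_B$ of types A and B that form a pair. Moreover, if $(\psi_A,\psi_B)$ is one such pair, then $(\psi_A',\psi_B')$ is such a pair if and only if there is $$G(\xi;\epsilon)=\sum_{j\ge0}G_j(\epsilon)\xi^{-j},\qquad G_0=1,\quad G_j\in\mathbb C((\epsilon))\ (j\ge1),$$ with $\psi_A'=G\,\psi_A$ and $\psi_B'=G^{-1}\psi_B$. -/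

import Mathlib

open scoped LaurentPolynomial

namespace AKNS

noncomputable section

section Coefficientwise

variable {R : Type*} [CommRing R]

/-- A derivation of `R`, applied to every coefficient of a formal Laurent series over `R`. -/
def laurentDer (D : R →+ R) : LaurentSeries R →+ LaurentSeries R where
  toFun f := f.map D
  map_zero' := by ext n; simp
  map_add' f g := by ext n; simp

theorem laurentDer_mul (D : R →+ R) (hD : ∀ a b, D (a * b) = a * D b + b * D a)
    (f g : LaurentSeries R) :
    laurentDer D (f * g) = f * laurentDer D g + g * laurentDer D f := by
  ext n
  have h1 : (f * laurentDer D g).coeff n = ∑ ij ∈ Finset.antidiagonal f.isPWO_support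
      g.isPWO_support n, f.coeff ij.1 * D (g.coeff ij.2) :=
    HahnSeries.coeff_mul_right' g.isPWO_support
      (HahnSeries.support_map_subset g (D : ZeroHom R R))
  have h2 : (laurentDer D f * g).coeff n = ∑ ij ∈ Finset.antidiagonal f.isPWO_support
      g.isPWO_support n, D (f.coeff ij.1) * g.coeff ij.2 :=
    HahnSeries.coeff_mul_left' f.isPWO_support
      (HahnSeries.support_map_subset f (D : ZeroHom R R))
  change D ((f * g).coeff n) = _
  rw [HahnSeries.coeff_add, mul_comm g, h1, h2, ← Finset.sum_add_distrib, HahnSeries.coeff_mul,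
    map_sum]
  exact Finset.sum_congr rfl fun x _ => by rw [hD, mul_comm (g.coeff _)]

/-- A derivation of `R`, applied to every coefficient of a formal power series over `R`. -/
def powerDer {σ : Type*} (D : R →+ R) : MvPowerSeries σ R →+ MvPowerSeries σ R where
  toFun f m := D (MvPowerSeries.coeff m f)
  map_zero' := by
    ext m
    change D (MvPowerSeries.coeff m 0) = 0
    simp
  map_add' f g := by
    ext m
    change D (MvPowerSeries.coeff m (f + g)) =
      D (MvPowerSeries.coeff m f) + D (MvPowerSeries.coeff m g)
    simp

theorem powerDer_mul {σ : Type*} (D : R →+ R) (hD : ∀ a b, D (a * b) = a * D b + b * D a)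
    (f g : MvPowerSeries σ R) :
    powerDer D (f * g) = f * powerDer D g + g * powerDer D f := by
  classical
  ext m
  change D (MvPowerSeries.coeff m (f * g)) = _
  rw [map_add, mul_comm g, MvPowerSeries.coeff_mul, MvPowerSeries.coeff_mul,
    MvPowerSeries.coeff_mul, map_sum, ← Finset.sum_add_distrib]
  refine Finset.sum_congr rfl fun x _ => ?_
  rw [hD, mul_comm (MvPowerSeries.coeff x.2 g)]
  rfl

/-- The extension of a derivation `D` of `R` to Laurent polynomials over `R` with `D T = w T`:
it sends `∑ aₙ Tⁿ` to `∑ (D aₙ + n w aₙ) Tⁿ`. When `T` stands for a formal exponential `exp α`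
and `w = D α`, this is the chain rule `D (exp (n α)) = n (D α) exp (n α)`. -/
def expDer (D : R →+ R) (w : R) : R[T;T⁻¹] →+ R[T;T⁻¹] where
  toFun f := AddMonoidAlgebra.ofCoeff
    (Finsupp.onFinset f.coeff.support (fun n => D (f.coeff n) + (n : R) * w * f.coeff n)
      (fun n hn => by
        rw [Finsupp.mem_support_iff]
        intro h
        simp [h] at hn))
  map_zero' := by ext n; simp
  map_add' f g := by ext n; simp; ring

end Coefficientwise

section Lax

variable {S : Type*} [CommRing S]

/-- The spectral parameter `ξ`, in the ring `S((ξ⁻¹))` of Laurent series in `ξ⁻¹`. -/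
def xi (S : Type*) [CommRing S] : LaurentSeries S := HahnSeries.single (-1) 1

/-- The part of a Laurent series in `ξ⁻¹` that is polynomial in `ξ`. -/
def plusPart (f : LaurentSeries S) : LaurentSeries S := HahnSeries.truncLT (1 : ℤ) f

/-- The potential `U` of the Lax operator `𝓛(ξ) = ε ∂_X + U`. -/
def laxU (q r : S) : Matrix (Fin 2) (Fin 2) (LaurentSeries S) :=
  !![-xi S, -HahnSeries.C q; HahnSeries.C r, xi S]

/-- The commutator `[𝓛(ξ), M] = ε M_X + U M - M U` of the operator `𝓛(ξ) = ε ∂_X + U` with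
(multiplication by) a matrix `M`. Here `D` is `∂_X` and `e` is `ε`. -/
def laxBracket (D : S →+ S) (e q r : S) (M : Matrix (Fin 2) (Fin 2) (LaurentSeries S)) :
    Matrix (Fin 2) (Fin 2) (LaurentSeries S) :=
  (HahnSeries.C e : LaurentSeries S) • M.map (laurentDer D) + laxU q r * M - M * laxU q r

/-- The defining properties of the basic matrix resolvent of `𝓛(ξ)`:
`R(ξ) - diag(2,0)` is a series in strictly negative powers of `ξ`,
`[𝓛(ξ), R(ξ)] = 0`, `tr R(ξ) = 2` and `det R(ξ) = 0`. -/
structure IsMatrixResolvent (D : S →+ S) (e q r : S)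
    (R : Matrix (Fin 2) (Fin 2) (LaurentSeries S)) : Prop where
  leading : ∀ i j, plusPart ((R - (!![2, 0; 0, 0] : Matrix (Fin 2) (Fin 2) (LaurentSeries S))) i j) = 0
  bracket : laxBracket D e q r R = 0
  trace : R.trace = 2
  det : R.det = 0

/-- The Laurent series `∑_{j ≥ 0} a_j ξ^{-(j+1)}`. -/
def tailSeries (a : ℕ → S) : LaurentSeries S :=
  HahnSeries.ofPowerSeries ℤ S (PowerSeries.X * PowerSeries.mk a)

theorem coeff_tailSeries_succ (a : ℕ → S) (j : ℕ) :
    (tailSeries a).coeff ((j + 1 : ℕ) : ℤ) = a j := by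
  rw [tailSeries, HahnSeries.ofPowerSeries_apply_coeff]
  simp [PowerSeries.coeff_succ_X_mul]

theorem coeff_tailSeries_of_nonpos (a : ℕ → S) {n : ℤ} (hn : n ≤ 0) :
    (tailSeries a).coeff n = 0 := by
  rcases eq_or_lt_of_le hn with rfl | h
  · have := HahnSeries.ofPowerSeries_apply_coeff (Γ := ℤ) (PowerSeries.X * PowerSeries.mk a) 0
    rw [tailSeries]
    simpa using this
  · rw [tailSeries, HahnSeries.ofPowerSeries_apply]
    apply HahnSeries.embDomain_of_notMem_range
    rintro ⟨m, rfl⟩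
    simp at h
    omega

theorem eq_tailSeries (f : LaurentSeries S) (hf : plusPart f = 0) :
    f = tailSeries fun j => f.coeff ((j + 1 : ℕ) : ℤ) := by
  ext n
  rcases le_or_gt n 0 with h | h
  · rw [coeff_tailSeries_of_nonpos _ h]
    have := congrArg (fun g => HahnSeries.coeff g n) hf
    simpa [plusPart, HahnSeries.coeff_truncLT, show n < 1 by omega] using this
  · obtain ⟨j, rfl⟩ : ∃ j : ℕ, n = ((j + 1 : ℕ) : ℤ) := ⟨(n - 1).toNat, by omega⟩
    rw [coeff_tailSeries_succ]

theorem exists_eq_tailSeries (f : LaurentSeries S) (hf : plusPart f = 0) :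
    ∃ a, f = tailSeries a :=
  ⟨_, eq_tailSeries f hf⟩

theorem plusPart_tailSeries (a : ℕ → S) : plusPart (tailSeries a) = 0 := by
  ext n
  rw [plusPart, HahnSeries.coeff_truncLT]
  split_ifs with h
  · rw [coeff_tailSeries_of_nonpos _ (by omega)]
    rfl
  · rfl

theorem tailSeries_injective : Function.Injective (tailSeries (S := S)) := fun a b h => by
  ext j
  rw [← coeff_tailSeries_succ a, ← coeff_tailSeries_succ b, h]

theorem C_add_tailSeries_eq_zero (x : S) (a : ℕ → S) :
    HahnSeries.C x + tailSeries a = 0 ↔ x = 0 ∧ ∀ j, a j = 0 := by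
  constructor
  · intro h
    constructor
    · have := congrArg (fun g => HahnSeries.coeff g 0) h
      simpa [coeff_tailSeries_of_nonpos] using this
    · intro j
      have := congrArg (fun g => HahnSeries.coeff g ((j + 1 : ℕ) : ℤ)) h
      simp only [HahnSeries.coeff_add, coeff_tailSeries_succ, HahnSeries.C_apply] at this
      rw [HahnSeries.coeff_single_of_ne (by omega)] at this
      simpa using this
  · rintro ⟨rfl, h⟩
    obtain rfl : a = 0 := funext h
    have : PowerSeries.mk (0 : ℕ → S) = 0 := by ext; simp
    simp [tailSeries, this]

theorem tailSeries_add (a b : ℕ → S) :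
    tailSeries a + tailSeries b = tailSeries fun j => a j + b j := by
  rw [tailSeries, tailSeries, tailSeries, ← map_add, ← mul_add]
  congr 2

theorem C_mul_tailSeries (x : S) (a : ℕ → S) :
    HahnSeries.C x * tailSeries a = tailSeries fun j => x * a j := by
  rw [tailSeries, tailSeries, ← HahnSeries.ofPowerSeries_C, ← map_mul]
  congr 1
  rw [mul_left_comm]
  congr 1
  ext j
  simp

theorem laurentDer_tailSeries (D : S →+ S) (a : ℕ → S) :
    laurentDer D (tailSeries a) = tailSeries fun j => D (a j) := by
  ext n
  change D ((tailSeries a).coeff n) = _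
  rcases le_or_gt n 0 with h | h
  · rw [coeff_tailSeries_of_nonpos _ h, coeff_tailSeries_of_nonpos _ h, map_zero]
  · obtain ⟨j, rfl⟩ : ∃ j : ℕ, n = ((j + 1 : ℕ) : ℤ) := ⟨(n - 1).toNat, by omega⟩
    rw [coeff_tailSeries_succ, coeff_tailSeries_succ]

theorem xi_mul_tailSeries (a : ℕ → S) :
    xi S * tailSeries a = HahnSeries.C (a 0) + tailSeries fun j => a (j + 1) := by
  have h : PowerSeries.mk a = PowerSeries.C (a 0) + PowerSeries.X * PowerSeries.mk
      fun j => a (j + 1) := by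
    ext j
    cases j with
    | zero => simp
    | succ j => simp [PowerSeries.coeff_succ_X_mul]
  have hx : xi S * HahnSeries.single 1 1 = 1 := by
    rw [xi, HahnSeries.single_mul_single]
    simp
  rw [tailSeries, map_mul, HahnSeries.ofPowerSeries_X, ← mul_assoc, hx, one_mul, h, map_add,
    HahnSeries.ofPowerSeries_C]
  rfl

theorem tailSeries_mul (a b : ℕ → S) :
    tailSeries a * tailSeries b = tailSeries fun j =>
      Nat.casesOn j 0 fun k => ∑ i : Fin (k + 1), a i * b (k - i) := by
  rw [tailSeries, tailSeries, tailSeries, ← map_mul]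
  congr 1
  rw [mul_assoc]
  congr 1
  ext j
  cases j with
  | zero => simp
  | succ k =>
    rw [mul_left_comm, PowerSeries.coeff_succ_X_mul, PowerSeries.coeff_mul, PowerSeries.coeff_mk,
      Finset.Nat.sum_antidiagonal_eq_sum_range_succ_mk, Finset.sum_range]
    simp

theorem isMatrixResolvent_tailSeries_iff (D : S →+ S)
    (hD : ∀ a b, D (a * b) = a * D b + b * D a) (e q r : S) (a b c : ℕ → S)
    (h2 : IsUnit (2 : S)) :
    IsMatrixResolvent D e q r
      !![2 + tailSeries a, tailSeries b; tailSeries c, -tailSeries a] ↔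
    (a 0 = 0 ∧ ∀ k, 2 * a (k + 1) + ∑ i : Fin (k + 1), (a i * a (k - i) + b i * c (k - i)) = 0) ∧
    (q - b 0 = 0 ∧ ∀ j, e * D (b j) + 2 * q * a j - 2 * b (j + 1) = 0) ∧
    (r + c 0 = 0 ∧ ∀ j, e * D (c j) + 2 * r * a j + 2 * c (j + 1) = 0) := by
  have hD1 : D 1 = 0 := by simpa using hD 1 1
  have hC1 : laurentDer D 2 = 0 := by
    have h := laurentDer_mul D hD 1 1
    rw [← one_add_one_eq_two, map_add]
    simp only [mul_one, one_mul, left_eq_add] at h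
    rw [h, add_zero]
  have h2C : IsUnit (2 : LaurentSeries S) := by
    have h := h2.map (HahnSeries.C : S →+* LaurentSeries S)
    rwa [map_ofNat] at h
  -- the determinant
  have hdet : (2 + tailSeries a) * -tailSeries a - tailSeries b * tailSeries c = 0 ↔
      (a 0 = 0 ∧ ∀ k, 2 * a (k + 1) +
        ∑ i : Fin (k + 1), (a i * a (k - i) + b i * c (k - i)) = 0) := by
    have : (2 + tailSeries a) * -tailSeries a - tailSeries b * tailSeries c =
        -(HahnSeries.C 0 + (HahnSeries.C 2 * tailSeries a + (tailSeries a * tailSeries a +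
          tailSeries b * tailSeries c))) := by
      simp only [map_ofNat, map_zero]
      ring
    rw [this, neg_eq_zero, tailSeries_mul, tailSeries_mul, C_mul_tailSeries, tailSeries_add,
      tailSeries_add, C_add_tailSeries_eq_zero]
    constructor
    · rintro ⟨-, h⟩
      refine ⟨?_, fun k => ?_⟩
      · have := h 0
        change 2 * a 0 + (0 + 0) = 0 at this
        rw [add_zero, add_zero] at this
        exact (h2.mul_right_eq_zero).1 this
      · rw [Finset.sum_add_distrib]
        exact h (k + 1)
    · rintro ⟨h0, h⟩
      refine ⟨rfl, fun k => ?_⟩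
      cases k with
      | zero => simp [h0]
      | succ k =>
        have := h k
        rw [Finset.sum_add_distrib] at this
        exact this
  have hb : HahnSeries.C e * laurentDer D (tailSeries b) + HahnSeries.C 2 *
        (HahnSeries.C q * tailSeries a) + HahnSeries.C 2 * HahnSeries.C q -
        HahnSeries.C 2 * (xi S * tailSeries b) = 0 ↔
      (q - b 0 = 0 ∧ ∀ j, e * D (b j) + 2 * q * a j - 2 * b (j + 1) = 0) := by
    have : HahnSeries.C e * laurentDer D (tailSeries b) + HahnSeries.C 2 *
        (HahnSeries.C q * tailSeries a) + HahnSeries.C 2 * HahnSeries.C q -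
        HahnSeries.C 2 * (xi S * tailSeries b) =
        HahnSeries.C (2 * (q - b 0)) +
          tailSeries fun j => e * D (b j) + 2 * q * a j - 2 * b (j + 1) := by
      have h : (tailSeries fun j => e * D (b j) + 2 * q * a j - 2 * b (j + 1)) =
          HahnSeries.C e * laurentDer D (tailSeries b) + HahnSeries.C (2 * q) * tailSeries a +
            HahnSeries.C (-2) * tailSeries fun j => b (j + 1) := by
        rw [laurentDer_tailSeries, C_mul_tailSeries, C_mul_tailSeries, C_mul_tailSeries,
          tailSeries_add, tailSeries_add]
        congr 1
        ext j
        ring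
      rw [h, xi_mul_tailSeries]
      simp only [map_mul, map_sub, map_neg]
      ring
    rw [this, C_add_tailSeries_eq_zero, h2.mul_right_eq_zero]
  have hc : HahnSeries.C e * laurentDer D (tailSeries c) + HahnSeries.C 2 *
        (HahnSeries.C r * tailSeries a) + HahnSeries.C 2 * HahnSeries.C r +
        HahnSeries.C 2 * (xi S * tailSeries c) = 0 ↔
      (r + c 0 = 0 ∧ ∀ j, e * D (c j) + 2 * r * a j + 2 * c (j + 1) = 0) := by
    have : HahnSeries.C e * laurentDer D (tailSeries c) + HahnSeries.C 2 *
        (HahnSeries.C r * tailSeries a) + HahnSeries.C 2 * HahnSeries.C r +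
        HahnSeries.C 2 * (xi S * tailSeries c) =
        HahnSeries.C (2 * (r + c 0)) +
          tailSeries fun j => e * D (c j) + 2 * r * a j + 2 * c (j + 1) := by
      have h : (tailSeries fun j => e * D (c j) + 2 * r * a j + 2 * c (j + 1)) =
          HahnSeries.C e * laurentDer D (tailSeries c) + HahnSeries.C (2 * r) * tailSeries a +
            HahnSeries.C 2 * tailSeries fun j => c (j + 1) := by
        rw [laurentDer_tailSeries, C_mul_tailSeries, C_mul_tailSeries, C_mul_tailSeries,
          tailSeries_add, tailSeries_add]
      rw [h, xi_mul_tailSeries]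
      simp only [map_mul, map_add]
      ring
    rw [this, C_add_tailSeries_eq_zero, h2.mul_right_eq_zero]
  rw [← hdet, ← hb, ← hc]
  simp only [map_ofNat]
  constructor
  · rintro ⟨-, hbr, -, hdt⟩
    refine ⟨by simpa [Matrix.det_fin_two] using hdt, ?_, ?_⟩
    · have := congrFun (congrFun hbr 0) 1
      simp only [laxBracket, laxU, Matrix.sub_apply, Matrix.add_apply, Matrix.smul_apply,
        Matrix.map_apply, Matrix.mul_apply, Fin.sum_univ_two, smul_eq_mul, Matrix.of_apply,
        Matrix.cons_val_zero, Matrix.cons_val_one, Matrix.zero_apply, Matrix.cons_val'] at this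
      rw [← this]
      ring
    · have := congrFun (congrFun hbr 1) 0
      simp only [laxBracket, laxU, Matrix.sub_apply, Matrix.add_apply, Matrix.smul_apply,
        Matrix.map_apply, Matrix.mul_apply, Fin.sum_univ_two, smul_eq_mul, Matrix.of_apply,
        Matrix.cons_val_zero, Matrix.cons_val_one, Matrix.zero_apply, Matrix.cons_val'] at this
      rw [← this]
      ring
  · rintro ⟨hdt, hb', hc'⟩
    -- the diagonal entries of the bracket, from the derivative of the determinant
    have hu : IsUnit (2 * (1 + tailSeries a)) := by
      refine h2C.mul ?_
      have : 1 + tailSeries a = HahnSeries.ofPowerSeries ℤ S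
          (1 + PowerSeries.X * PowerSeries.mk a) := by
        rw [map_add, map_one, tailSeries]
      rw [this]
      refine IsUnit.map _ ?_
      rw [PowerSeries.isUnit_iff_constantCoeff]
      simp
    have hder := congrArg (laurentDer D) hdt
    have ha : HahnSeries.C e * laurentDer D (tailSeries a) - HahnSeries.C q * tailSeries c -
        HahnSeries.C r * tailSeries b = 0 := by
      refine (hu.mul_right_eq_zero).1 ?_
      simp only [map_sub, map_zero, laurentDer_mul D hD, map_neg, map_add, hC1] at hder
      linear_combination -(HahnSeries.C e) * hder - tailSeries c * hb' - tailSeries b * hc'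
    refine ⟨?_, ?_, ?_, ?_⟩
    · intro i j
      have hneg : -tailSeries a = tailSeries fun j => -1 * a j := by
        rw [← C_mul_tailSeries]
        simp
      fin_cases i <;> fin_cases j <;>
        simp [plusPart_tailSeries, hneg]
    · ext1 i j
      fin_cases i <;> fin_cases j <;>
        simp only [laxBracket, laxU, Matrix.sub_apply, Matrix.add_apply, Matrix.smul_apply,
          Matrix.map_apply, Matrix.mul_apply, Fin.sum_univ_two, smul_eq_mul, Matrix.of_apply,
          Matrix.cons_val_zero, Matrix.cons_val_one, Matrix.zero_apply, Matrix.cons_val',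
          Fin.zero_eta, Fin.mk_one, map_add, map_neg, hC1]
      · linear_combination ha
      · linear_combination hb'
      · linear_combination hc'
      · linear_combination -ha
    · simp [Matrix.trace_fin_two]
    · simpa [Matrix.det_fin_two] using hdt

variable [Algebra ℂ S]

/-- The coefficients `(A_j, B_j, C_j)` of the basic matrix resolvent:
`A_0 = 0`, `B_0 = q`, `C_0 = -r`, `A_{j+1} = -½ ∑_{i=0}^{j} (A_i A_{j-i} + B_i C_{j-i})`,
`B_{j+1} = ½ (ε ∂_X B_j + 2 q A_j)`, `C_{j+1} = -½ (ε ∂_X C_j + 2 r A_j)`. -/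
def resCoeff (D : S →+ S) (e q r : S) : ℕ → S × S × S
  | 0 => (0, q, -r)
  | j + 1 =>
    (-algebraMap ℂ S (1 / 2) * ∑ i : Fin (j + 1),
        ((resCoeff D e q r i).1 * (resCoeff D e q r (j - i)).1 +
          (resCoeff D e q r i).2.1 * (resCoeff D e q r (j - i)).2.2),
      algebraMap ℂ S (1 / 2) * (e * D (resCoeff D e q r j).2.1 + 2 * q * (resCoeff D e q r j).1),
      -algebraMap ℂ S (1 / 2) * (e * D (resCoeff D e q r j).2.2 + 2 * r * (resCoeff D e q r j).1))
  termination_by j => j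
  decreasing_by all_goals omega

/-- The basic matrix resolvent `R(ξ)` of `𝓛(ξ)`. By `isMatrixResolvent_iff` below it is the unique
matrix with the defining properties `IsMatrixResolvent`. -/
def resolvent (D : S →+ S) (e q r : S) : Matrix (Fin 2) (Fin 2) (LaurentSeries S) :=
  !![2 + tailSeries fun j => (resCoeff D e q r j).1, tailSeries fun j => (resCoeff D e q r j).2.1;
    tailSeries fun j => (resCoeff D e q r j).2.2, -tailSeries fun j => (resCoeff D e q r j).1]

/-- `V_j(ξ) = (ξ^{j+1} R(ξ))₊`. -/
def laxV (D : S →+ S) (e q r : S) (j : ℕ) : Matrix (Fin 2) (Fin 2) (LaurentSeries S) :=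
  (xi S ^ (j + 1) • resolvent D e q r).map plusPart

theorem isMatrixResolvent_iff (D : S →+ S) (hD : ∀ a b, D (a * b) = a * D b + b * D a)
    (e q r : S) (R : Matrix (Fin 2) (Fin 2) (LaurentSeries S)) :
    IsMatrixResolvent D e q r R ↔ R = resolvent D e q r := by
  have hh : (2 : S) * algebraMap ℂ S (1 / 2) = 1 := by
    rw [← map_ofNat (algebraMap ℂ S) 2, ← map_mul]
    norm_num
  have h2 : IsUnit (2 : S) := IsUnit.of_mul_eq_one _ hh
  constructor
  · intro h
    have h01 : plusPart (R 0 1) = 0 := by simpa using h.leading 0 1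
    have h10 : plusPart (R 1 0) = 0 := by simpa using h.leading 1 0
    have h00 : plusPart (R 0 0 - 2) = 0 := by simpa using h.leading 0 0
    have htr := h.trace
    obtain ⟨a, ha⟩ : ∃ a, R 0 0 - 2 = tailSeries a := exists_eq_tailSeries _ h00
    obtain ⟨b, hb⟩ : ∃ b, R 0 1 = tailSeries b := exists_eq_tailSeries _ h01
    obtain ⟨c, hc⟩ : ∃ c, R 1 0 = tailSeries c := exists_eq_tailSeries _ h10
    have hR : R = !![2 + tailSeries a, tailSeries b; tailSeries c, -tailSeries a] := by
      rw [Matrix.trace_fin_two] at htr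
      ext1 i j
      fin_cases i <;> fin_cases j
      · simp [← ha]
      · simp [hb]
      · simp [hc]
      · simp only [Fin.mk_one, Matrix.of_apply, Matrix.cons_val', Matrix.cons_val_one,
          Matrix.cons_val_fin_one]
        linear_combination htr - ha
    rw [hR, isMatrixResolvent_tailSeries_iff D hD e q r a b c h2] at h
    obtain ⟨⟨ha0, ha'⟩, ⟨hb0, hb'⟩, ⟨hc0, hc'⟩⟩ := h
    have key : ∀ j, resCoeff D e q r j = (a j, b j, c j) := by
      intro j
      induction j using Nat.strong_induction_on with
      | _ j ih =>
        cases j with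
        | zero =>
          rw [resCoeff, ha0, ← sub_eq_zero.1 hb0, eq_neg_of_add_eq_zero_right hc0]
        | succ j =>
          rw [resCoeff, ih j (by omega)]
          have hs : ∀ i : Fin (j + 1), resCoeff D e q r i = (a i, b i, c i) :=
            fun i => ih i (by omega)
          have hs' : ∀ i : Fin (j + 1), resCoeff D e q r (j - i) =
              (a (j - i), b (j - i), c (j - i)) := fun i => ih (j - i) (by omega)
          simp only [hs, hs', Prod.mk.injEq]
          refine ⟨?_, ?_, ?_⟩
          · linear_combination -algebraMap ℂ S (1 / 2) * ha' j + a (j + 1) * hh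
          · linear_combination algebraMap ℂ S (1 / 2) * hb' j + b (j + 1) * hh
          · linear_combination -algebraMap ℂ S (1 / 2) * hc' j + c (j + 1) * hh
    rw [hR, resolvent]
    simp only [key]
  · rintro rfl
    rw [resolvent, isMatrixResolvent_tailSeries_iff D hD e q r _ _ _ h2]
    refine ⟨⟨by rw [resCoeff], fun k => ?_⟩, ⟨by rw [resCoeff, sub_self], fun j => ?_⟩,
      ⟨by rw [resCoeff, add_neg_cancel], fun j => ?_⟩⟩
    · rw [resCoeff]
      linear_combination -(∑ i : Fin (k + 1),
        ((resCoeff D e q r i).1 * (resCoeff D e q r (k - i)).1 +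
          (resCoeff D e q r i).2.1 * (resCoeff D e q r (k - i)).2.2)) * hh
    · rw [resCoeff]
      linear_combination
        -(e * D (resCoeff D e q r j).2.1 + 2 * q * (resCoeff D e q r j).1) * hh
    · rw [resCoeff]
      linear_combination
        -(e * D (resCoeff D e q r j).2.2 + 2 * r * (resCoeff D e q r j).1) * hh

end Lax

section Hierarchy

variable {A : Type*} [CommRing A]

/-- The ring `A((ε))[[t₁, t₂, …]]`; the variable with index `k : ℕ` is `t_{k+1}`, while `t₀ = X`
is the variable on which the elements of `A` depend. -/
abbrev TimeRing (A : Type*) [CommRing A] : Type _ := MvPowerSeries ℕ (LaurentSeries A)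

/-- The parameter `ε`. -/
def eps (A : Type*) [CommRing A] : TimeRing A := MvPowerSeries.C (HahnSeries.single 1 1)

/-- The inverse `ε⁻¹` of the parameter `ε`. -/
def epsInv (A : Type*) [CommRing A] : TimeRing A := MvPowerSeries.C (HahnSeries.single (-1) 1)

variable [Algebra ℂ A]

/-- The derivations `∂/∂t_k` of `A((ε))[[t₁, t₂, …]]`, where `∂/∂t₀ = ∂_X` acts on coefficients. -/
def timeDer (δ : Derivation ℂ A A) : ℕ → (TimeRing A →+ TimeRing A)
  | 0 => powerDer (laurentDer δ.toLinearMap.toAddMonoidHom)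
  | k + 1 => (MvPowerSeries.pderiv (LaurentSeries A) k).toLinearMap.toAddMonoidHom

theorem timeDer_mul (δ : Derivation ℂ A A) (k : ℕ) (f g : TimeRing A) :
    timeDer δ k (f * g) = f * timeDer δ k g + g * timeDer δ k f := by
  cases k with
  | zero =>
    exact powerDer_mul _ (laurentDer_mul _ fun a b => by simp) f g
  | succ k => exact (MvPowerSeries.pderiv (LaurentSeries A) k).leibniz f g

/-- `V_j(ξ)` for the pair `(q(t; ε), r(t; ε))`. -/
def timeV (δ : Derivation ℂ A A) (q r : TimeRing A) (j : ℕ) :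
    Matrix (Fin 2) (Fin 2) (LaurentSeries (TimeRing A)) :=
  laxV (timeDer δ 0) (eps A) q r j

/-- `(q, r)` is a solution of the AKNS hierarchy `∂𝓛/∂t_j = 2^j ε⁻¹ [V_j, 𝓛]`, `j ≥ 0`. -/
def IsAKNSSolution (δ : Derivation ℂ A A) (q r : TimeRing A) : Prop :=
  ∀ j : ℕ, (laxU q r).map (laurentDer (timeDer δ j)) =
    (HahnSeries.C (2 ^ j * epsInv A) : LaurentSeries (TimeRing A)) •
      (-laxBracket (timeDer δ 0) (eps A) q r (timeV δ q r j))

/-- The ring to which formal wave functions belong: finite sums of terms `a · exp(n α)` with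
`n : ℤ`, `a ∈ A((ε))[[t₁, t₂, …]]((ξ⁻¹))` and `α = ε⁻¹ ∑_{k ≥ 0} 2^k t_k ξ^{k+1}`. The formal
exponential `exp α` is the variable `T` of the Laurent polynomials. -/
abbrev WaveRing (A : Type*) [CommRing A] : Type _ := (LaurentSeries (TimeRing A))[T;T⁻¹]

/-- The derivation `∂/∂t_k` of the wave ring, for which
`∂ (exp α) / ∂t_k = ε⁻¹ 2^k ξ^{k+1} exp α`. -/
def waveDer (δ : Derivation ℂ A A) (k : ℕ) : WaveRing A →+ WaveRing A :=
  expDer (laurentDer (timeDer δ k))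
    (HahnSeries.C (2 ^ k * epsInv A) * xi (TimeRing A) ^ (k + 1))

/-- An element of `A((ε))[[t₁, t₂, …]]` as an element of the wave ring. -/
def ofTime (f : TimeRing A) : WaveRing A := LaurentPolynomial.C (HahnSeries.C f)

/-- A power series in `ξ⁻¹` over `A((ε))[[t₁, t₂, …]]` as an element of the wave ring. -/
def ofSeries (f : PowerSeries (TimeRing A)) : WaveRing A :=
  LaurentPolynomial.C (HahnSeries.ofPowerSeries ℤ (TimeRing A) f)

/-- The spectral parameter `ξ` as an element of the wave ring. -/
def waveXi (A : Type*) [CommRing A] : WaveRing A := LaurentPolynomial.C (xi (TimeRing A))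

/-- `w` is the quotient `a / q`. In the theorem `q` is not a zero divisor, so there is at most one
such `w`. -/
def IsQuotient (a : WaveRing A) (q : TimeRing A) (w : WaveRing A) : Prop := ofTime q * w = a

/-- The vector `Ψ = (ψ, (ε ψ_X - ξ ψ) / q)ᵀ` is well defined and satisfies
`∂Ψ/∂t_k = ε⁻¹ 2^k ((ξ^{k+1} R)₊ - ξ^{k+1} I) Ψ` for all `k ≥ 0`. -/
def SatisfiesWaveEquations (δ : Derivation ℂ A A) (q r : TimeRing A) (ψ : WaveRing A) : Prop :=
  ∃ w : WaveRing A,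
    IsQuotient (ofTime (eps A) * waveDer δ 0 ψ - waveXi A * ψ) q w ∧
    ∀ k : ℕ, (fun i => waveDer δ k (![ψ, w] i)) =
      ofTime (2 ^ k * epsInv A) •
        (((timeV δ q r k - (xi (TimeRing A) ^ (k + 1)) •
            (1 : Matrix (Fin 2) (Fin 2) (LaurentSeries (TimeRing A)))).map
          LaurentPolynomial.C).mulVec ![ψ, w])

/-- Formal wave functions of type A: `ψ = φ exp α`, where `φ` is a power series in `ξ⁻¹` with
leading coefficient `1`. -/
def IsWaveA (δ : Derivation ℂ A A) (q r : TimeRing A) (ψ : WaveRing A) : Prop :=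
  (∃ φ : PowerSeries (TimeRing A), PowerSeries.constantCoeff φ = 1 ∧
    ψ = ofSeries φ * LaurentPolynomial.T 1) ∧
  SatisfiesWaveEquations δ q r ψ

/-- Formal wave functions of type B: `ψ = φ q exp (-α)`, where `φ` is a power series in `ξ⁻¹` with
leading coefficient `1`. -/
def IsWaveB (δ : Derivation ℂ A A) (q r : TimeRing A) (ψ : WaveRing A) : Prop :=
  (∃ φ : PowerSeries (TimeRing A), PowerSeries.constantCoeff φ = 1 ∧
    ψ = ofSeries φ * ofTime q * LaurentPolynomial.T (-1)) ∧
  SatisfiesWaveEquations δ q r ψ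

/-- `ψA`, `ψB` are wave functions of types A and B that form a pair:
`d = ε (ψA ψB_X - ψA_X ψB) / q` equals `-2 ξ`. -/
structure IsWavePair (δ : Derivation ℂ A A) (q r : TimeRing A) (ψA ψB : WaveRing A) : Prop where
  typeA : IsWaveA δ q r ψA
  typeB : IsWaveB δ q r ψB
  pair : IsQuotient (ofTime (eps A) * (ψA * waveDer δ 0 ψB - waveDer δ 0 ψA * ψB)) q
    (-2 * waveXi A)

/-- An element of `ℂ((ε))[[ξ⁻¹]]` as an element of the wave ring. -/
def ofConst (A : Type*) [CommRing A] [Algebra ℂ A] (G : PowerSeries (LaurentSeries ℂ)) :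
    WaveRing A :=
  ofSeries (PowerSeries.mk fun j =>
    MvPowerSeries.C ((PowerSeries.coeff j G).map (algebraMap ℂ A)))

end Hierarchy

end

end AKNS

/-! The resolvent `R` has trace 2 and determinant 0, so it has rank one; the wave function of type A
comes from its image and that of type B from its kernel. Write `W_k` for `2^k ε⁻¹ (ξ^{k+1} R)₊` and
`P_k` for the same expression without truncation. The hierarchy gives `∂R/∂t_k = [W_k, R]`
(`resolvent_flow`), and hence the zero curvature equations for the `W_k` (`zero_curvature`).

Existence. The image of `R` is spanned by `(1, y)` with `y = R₁₀ / R₀₀`. The flows preserve it, so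
`y` satisfies Riccati equations, and a solution along this line must have logarithmic derivatives
given by the first entry of `W_k (1, y)`, up to the explicit terms in `ξ^{k+1}`. These form a closed
system by zero curvature. They contain only negative powers of `ξ`, because `(1, y)` is an
eigenvector of `P_k`. The X-component is `ε⁻¹ q y`, with coefficients built from `V`. Since `V` lies
in the image of the derivation, the system can be integrated, first in `X` at zero times and then in
the remaining times (`exists_potential`), and the potential can be exponentiated (`exists_exp`).
This gives the factor `φ` of type A. The vector `φ⁻¹ ξ (R₀₁, -R₀₀)` in the kernel of `R` gives type
B; its first entry is `q` times a series with leading coefficient 1 because `q` divides `q_X`. The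
determinant of the two solutions is `-ξ tr R = -2ξ`.

Uniqueness. The linear system is trace free, so determinants of two solutions are constant in all
times. For two solutions of the same type the determinant carries the factor `exp (±2α)`, and a
nonzero Laurent series times such a factor cannot be constant. Hence solutions of the same type are
proportional, and Cramer's rule gives the factors as mixed determinants divided by `-2ξ`
(`exists_const_of_det`). These factors are constants, hence have coefficients in `ℂ((ε))`, and the
normalisation makes them mutually inverse. -/

namespace AKNS

/-! ### Splitting of Laurent series into polynomials in `ξ` and negative powers; index `n` stands
for `ξ⁻ⁿ`. -/

section LaurentBasics

variable {S : Type*} [CommRing S]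

theorem laurentDer_coeff (D : S →+ S) (f : LaurentSeries S) (n : ℤ) :
    (laurentDer D f).coeff n = D (f.coeff n) := rfl

theorem laurentDer_C (D : S →+ S) (x : S) :
    laurentDer D (HahnSeries.C x) = HahnSeries.C (D x) := by
  ext n
  rw [laurentDer_coeff, HahnSeries.C_apply, HahnSeries.C_apply]
  by_cases h : n = 0
  · subst h; simp
  · simp [HahnSeries.coeff_single_of_ne h]

theorem coeff_C_mul (x : S) (f : LaurentSeries S) (n : ℤ) :
    (HahnSeries.C x * f).coeff n = x * f.coeff n := by
  rw [HahnSeries.C_mul_eq_smul]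
  simp

theorem coeff_xi_mul (f : LaurentSeries S) (n : ℤ) :
    (xi S * f).coeff n = f.coeff (n + 1) := by
  have := HahnSeries.coeff_single_mul_add (r := (1 : S)) (x := f) (a := n + 1) (b := (-1 : ℤ))
  simpa [xi] using this

theorem isUnit_xi : IsUnit (xi S) := by
  refine IsUnit.of_mul_eq_one (HahnSeries.single 1 1) ?_
  rw [xi, HahnSeries.single_mul_single]
  simp

theorem exists_coeff_eq_zero_of_lt (f : LaurentSeries S) : ∃ N : ℤ, ∀ n < N, f.coeff n = 0 :=
  ⟨f.order, fun _ hn => HahnSeries.coeff_eq_zero_of_lt_order hn⟩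

/-- A Laurent series vanishes if its coefficients vanish recursively. -/
theorem eq_zero_of_forall_coeff (f : LaurentSeries S)
    (h : ∀ n : ℤ, (∀ i < n, f.coeff i = 0) → f.coeff n = 0) : f = 0 := by
  obtain ⟨N, hN⟩ := exists_coeff_eq_zero_of_lt f
  have key : ∀ k : ℕ, ∀ i < N + k, f.coeff i = 0 := by
    intro k
    induction k with
    | zero => simpa using hN
    | succ k ih =>
      intro i hi
      rcases lt_or_ge i (N + k) with h1 | h1
      · exact ih i h1
      · obtain rfl : i = N + k := by push_cast at hi; omega
        exact h _ ih
  ext n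
  exact key (n - N + 1).toNat n (by omega)

theorem plusPart_coeff (f : LaurentSeries S) (n : ℤ) :
    (plusPart f).coeff n = if n < 1 then f.coeff n else 0 := by
  rw [plusPart, HahnSeries.coeff_truncLT]

theorem plusPart_eq_zero_iff (f : LaurentSeries S) :
    plusPart f = 0 ↔ ∀ n < 1, f.coeff n = 0 := by
  constructor
  · intro h n hn
    have := congrArg (fun g => HahnSeries.coeff g n) h
    simpa [plusPart_coeff, hn] using this
  · intro h
    ext n
    rw [plusPart_coeff]
    split_ifs with hn
    · exact h n hn
    · rfl

variable (S) in
/-- The series in strictly negative powers of `ξ`. -/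
def minusSubgroup : AddSubgroup (LaurentSeries S) where
  carrier := {f | ∀ n < 1, f.coeff n = 0}
  zero_mem' := by intro n _; rfl
  add_mem' {f g} hf hg := by
    intro n hn
    rw [HahnSeries.coeff_add, hf n hn, hg n hn, add_zero]
  neg_mem' {f} hf := by
    intro n hn
    rw [HahnSeries.coeff_neg, hf n hn, neg_zero]

variable (S) in
/-- The polynomials in `ξ`. -/
def plusSubgroup : AddSubgroup (LaurentSeries S) where
  carrier := {f | ∀ n, 1 ≤ n → f.coeff n = 0}
  zero_mem' := by intro n _; rfl
  add_mem' {f g} hf hg := by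
    intro n hn
    rw [HahnSeries.coeff_add, hf n hn, hg n hn, add_zero]
  neg_mem' {f} hf := by
    intro n hn
    rw [HahnSeries.coeff_neg, hf n hn, neg_zero]

theorem mul_mem_minus {f g : LaurentSeries S} (hf : f ∈ minusSubgroup S)
    (hg : g ∈ minusSubgroup S) : f * g ∈ minusSubgroup S := by
  intro n hn
  rw [HahnSeries.coeff_mul]
  refine Finset.sum_eq_zero fun ij hij => ?_
  have h := (Finset.mem_antidiagonal.1 hij).2.2
  rcases lt_or_ge ij.1 1 with h1 | h1
  · rw [hf _ h1, zero_mul]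
  · rw [hg ij.2 (by omega), mul_zero]

theorem mul_mem_plus {f g : LaurentSeries S} (hf : f ∈ plusSubgroup S)
    (hg : g ∈ plusSubgroup S) : f * g ∈ plusSubgroup S := by
  intro n hn
  rw [HahnSeries.coeff_mul]
  refine Finset.sum_eq_zero fun ij hij => ?_
  have h := (Finset.mem_antidiagonal.1 hij).2.2
  rcases lt_or_ge ij.1 1 with h1 | h1
  · rw [hg ij.2 (by omega), mul_zero]
  · rw [hf _ h1, zero_mul]

theorem C_mul_mem_minus (x : S) {f : LaurentSeries S} (hf : f ∈ minusSubgroup S) :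
    HahnSeries.C x * f ∈ minusSubgroup S := by
  intro n hn
  rw [coeff_C_mul, hf n hn, mul_zero]

theorem C_mul_mem_plus (x : S) {f : LaurentSeries S} (hf : f ∈ plusSubgroup S) :
    HahnSeries.C x * f ∈ plusSubgroup S := by
  intro n hn
  rw [coeff_C_mul, hf n hn, mul_zero]

theorem laurentDer_mem_minus (D : S →+ S) {f : LaurentSeries S} (hf : f ∈ minusSubgroup S) :
    laurentDer D f ∈ minusSubgroup S := by
  intro n hn
  rw [laurentDer_coeff, hf n hn, map_zero]

theorem laurentDer_mem_plus (D : S →+ S) {f : LaurentSeries S} (hf : f ∈ plusSubgroup S) :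
    laurentDer D f ∈ plusSubgroup S := by
  intro n hn
  rw [laurentDer_coeff, hf n hn, map_zero]

theorem plusPart_mem_plus (f : LaurentSeries S) : plusPart f ∈ plusSubgroup S := by
  intro n hn
  rw [plusPart_coeff, if_neg (by omega)]

theorem sub_plusPart_mem_minus (f : LaurentSeries S) : f - plusPart f ∈ minusSubgroup S := by
  intro n hn
  rw [HahnSeries.coeff_sub, plusPart_coeff, if_pos hn, sub_self]

theorem tailSeries_mem_minus (a : ℕ → S) : tailSeries a ∈ minusSubgroup S :=
  fun _ hn => coeff_tailSeries_of_nonpos a (by omega)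

/-- The splitting is direct. Zero curvature and the trace of `W_k` follow by exhibiting one quantity
on both sides of it. -/
theorem eq_zero_of_mem_plus_of_mem_minus {f : LaurentSeries S} (hp : f ∈ plusSubgroup S)
    (hm : f ∈ minusSubgroup S) : f = 0 := by
  ext n
  rcases lt_or_ge n 1 with h | h
  · exact hm n h
  · exact hp n h

/-- A factor in strictly negative powers of `ξ` shifts the index up by at least one, which is what
lets recursions on coefficients start. -/
theorem coeff_mul_eq_zero_of_mem_minus {f g : LaurentSeries S} (hf : f ∈ minusSubgroup S) (n : ℤ)
    (hg : ∀ i < n, g.coeff i = 0) : (f * g).coeff n = 0 := by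
  rw [HahnSeries.coeff_mul]
  refine Finset.sum_eq_zero fun ij hij => ?_
  have h := (Finset.mem_antidiagonal.1 hij).2.2
  rcases lt_or_ge ij.1 1 with h1 | h1
  · rw [hf _ h1, zero_mul]
  · rw [hg ij.2 (by omega), mul_zero]

theorem laurentDer_comm {D D' : S →+ S} (h : ∀ x, D (D' x) = D' (D x)) (f : LaurentSeries S) :
    laurentDer D (laurentDer D' f) = laurentDer D' (laurentDer D f) := by
  ext n
  exact h _

theorem map_one_of_leibniz {L : Type*} [CommRing L] (d : L →+ L)
    (hd : ∀ f g, d (f * g) = f * d g + g * d f) : d 1 = 0 := by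
  have := hd 1 1
  simpa using this

theorem map_natCast_of_leibniz {L : Type*} [CommRing L] (d : L →+ L)
    (hd : ∀ f g, d (f * g) = f * d g + g * d f) (n : ℕ) : d n = 0 := by
  induction n with
  | zero => simp
  | succ n ih => rw [Nat.cast_succ, map_add, ih, map_one_of_leibniz d hd, add_zero]

theorem map_pow_eq_zero_of_leibniz {L : Type*} [CommRing L] (d : L →+ L)
    (hd : ∀ f g, d (f * g) = f * d g + g * d f) {x : L} (hx : d x = 0) (n : ℕ) :
    d (x ^ n) = 0 := by
  induction n with
  | zero => rw [pow_zero, map_one_of_leibniz d hd]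
  | succ n ih => rw [pow_succ, hd, ih, hx, mul_zero, mul_zero, add_zero]

theorem laurentDer_xi {D : S →+ S} (hD : ∀ a b, D (a * b) = a * D b + b * D a) :
    laurentDer D (xi S) = 0 := by
  ext n
  rw [laurentDer_coeff, xi]
  by_cases h : n = -1
  · subst h; simp [map_one_of_leibniz D hD]
  · simp [HahnSeries.coeff_single_of_ne h]

theorem xi_mul_tailSeries_eq (a : ℕ → S) :
    xi S * tailSeries a = HahnSeries.ofPowerSeries ℤ S (PowerSeries.mk a) := by
  have hx : xi S * HahnSeries.single 1 1 = 1 := by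
    rw [xi, HahnSeries.single_mul_single]
    simp
  rw [tailSeries, map_mul, HahnSeries.ofPowerSeries_X, ← mul_assoc, hx, one_mul]

theorem xi_mem_plus : xi S ∈ plusSubgroup S := by
  intro n hn
  exact HahnSeries.coeff_single_of_ne (by omega)

theorem xi_pow_mem_plus (k : ℕ) : xi S ^ k ∈ plusSubgroup S := by
  induction k with
  | zero =>
    intro n hn
    rw [pow_zero]
    exact HahnSeries.coeff_single_of_ne (a := (0 : ℤ)) (by omega)
  | succ k ih => exact pow_succ (xi S) k ▸ mul_mem_plus ih xi_mem_plus

theorem plusPart_of_mem_plus_add_minus {f g : LaurentSeries S} (hf : f ∈ plusSubgroup S)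
    (hg : g ∈ minusSubgroup S) : plusPart (f + g) = f := by
  ext n
  rw [plusPart_coeff, HahnSeries.coeff_add]
  split_ifs with h
  · rw [hg n h, add_zero]
  · exact (hf n (by omega)).symm

theorem C_mem_plus (x : S) : HahnSeries.C x ∈ plusSubgroup S := by
  intro n hn
  exact HahnSeries.coeff_single_of_ne (by omega)

end LaurentBasics

/-! ### Matrix derivations and the commutator with the Lax operator. -/

section MatrixDerivation

variable {L : Type*} [CommRing L]

theorem map_matrix_mul (d : L →+ L) (hd : ∀ f g, d (f * g) = f * d g + g * d f)
    (M N : Matrix (Fin 2) (Fin 2) L) :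
    (M * N).map d = M.map d * N + M * N.map d := by
  ext i j
  simp only [Matrix.map_apply, Matrix.mul_apply, Fin.sum_univ_two, map_add, hd, Matrix.add_apply]
  ring

theorem map_matrix_add (d : L →+ L) (M N : Matrix (Fin 2) (Fin 2) L) :
    (M + N).map d = M.map d + N.map d := Matrix.map_add d (map_add d) M N

theorem map_matrix_sub (d : L →+ L) (M N : Matrix (Fin 2) (Fin 2) L) :
    (M - N).map d = M.map d - N.map d := Matrix.map_sub d (map_sub d) M N

theorem map_matrix_smul (d : L →+ L) (hd : ∀ f g, d (f * g) = f * d g + g * d f) {c : L}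
    (hc : d c = 0) (M : Matrix (Fin 2) (Fin 2) L) : (c • M).map d = c • M.map d := by
  ext i j
  simp [hd, hc]

end MatrixDerivation

section LaxBracket

variable {S : Type*} [CommRing S]

theorem laxBracket_mul (D : S →+ S) (hD : ∀ a b, D (a * b) = a * D b + b * D a) (e q r : S)
    (M N : Matrix (Fin 2) (Fin 2) (LaurentSeries S)) :
    laxBracket D e q r (M * N) = laxBracket D e q r M * N + M * laxBracket D e q r N := by
  rw [laxBracket, laxBracket, laxBracket, map_matrix_mul _ (laurentDer_mul D hD)]
  simp only [smul_add, sub_mul, add_mul, mul_sub, mul_add, Matrix.smul_mul, Matrix.mul_smul,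
    mul_assoc]
  abel

theorem laxBracket_sub (D : S →+ S) (e q r : S)
    (M N : Matrix (Fin 2) (Fin 2) (LaurentSeries S)) :
    laxBracket D e q r (M - N) = laxBracket D e q r M - laxBracket D e q r N := by
  rw [laxBracket, laxBracket, laxBracket, map_matrix_sub]
  simp only [smul_sub, sub_mul, mul_sub]
  abel

theorem laxBracket_smul (D : S →+ S) (hD : ∀ a b, D (a * b) = a * D b + b * D a) (e q r : S)
    {c : LaurentSeries S} (hc : laurentDer D c = 0)
    (M : Matrix (Fin 2) (Fin 2) (LaurentSeries S)) :
    laxBracket D e q r (c • M) = c • laxBracket D e q r M := by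
  rw [laxBracket, laxBracket, map_matrix_smul _ (laurentDer_mul D hD) hc]
  simp only [smul_sub, smul_add, Matrix.smul_mul, Matrix.mul_smul, smul_comm c]

/-- Differentiating `[𝓛, M]` along a flow that commutes with `D`. -/
theorem map_laxBracket (D D' : S →+ S) (hD' : ∀ a b, D' (a * b) = a * D' b + b * D' a)
    (hc : ∀ x, D' (D x) = D (D' x)) {e : S} (he : D' e = 0) (q r : S)
    (M : Matrix (Fin 2) (Fin 2) (LaurentSeries S)) :
    (laxBracket D e q r M).map (laurentDer D') =
      laxBracket D e q r (M.map (laurentDer D')) +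
        ((laxU q r).map (laurentDer D') * M - M * (laxU q r).map (laurentDer D')) := by
  have h1 : laurentDer D' (HahnSeries.C e) = 0 := by rw [laurentDer_C, he, map_zero]
  have h2 : (M.map (laurentDer D)).map (laurentDer D') =
      (M.map (laurentDer D')).map (laurentDer D) := by
    ext1 i j
    exact laurentDer_comm hc _
  rw [laxBracket, laxBracket, map_matrix_sub, map_matrix_add,
    map_matrix_smul _ (laurentDer_mul D' hD') h1, map_matrix_mul _ (laurentDer_mul D' hD'),
    map_matrix_mul _ (laurentDer_mul D' hD'), h2]
  abel

/-- A traceless matrix that commutes with `𝓛` and is orthogonal to a matrix of the form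
`diag(2, 0) + O(ξ⁻¹)` vanishes. -/
theorem eq_zero_of_laxBracket_eq_zero (h2 : IsUnit (2 : S)) (D : S →+ S) (e q r : S)
    (a b c : LaurentSeries S) (ha : a ∈ minusSubgroup S) (hb : b ∈ minusSubgroup S)
    (hc : c ∈ minusSubgroup S) (M : Matrix (Fin 2) (Fin 2) (LaurentSeries S))
    (hM : laxBracket D e q r M = 0) (htr : M.trace = 0)
    (hor : (!![2 + a, b; c, -a] * M).trace = 0) : M = 0 := by
  have h01 := congrFun (congrFun hM 0) 1
  have h10 := congrFun (congrFun hM 1) 0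
  simp only [laxBracket, laxU, Matrix.sub_apply, Matrix.add_apply, Matrix.smul_apply,
    Matrix.map_apply, Matrix.mul_apply, Fin.sum_univ_two, smul_eq_mul, Matrix.of_apply,
    Matrix.cons_val_zero, Matrix.cons_val_one, Matrix.zero_apply, Matrix.cons_val'] at h01 h10
  simp only [Matrix.trace_fin_two, Matrix.mul_apply, Fin.sum_univ_two, Matrix.of_apply,
    Matrix.cons_val_zero, Matrix.cons_val_one, Matrix.cons_val', Matrix.cons_val_fin_one]
    at htr hor
  set m := M 0 0
  set x := M 0 1
  set y := M 1 0
  have hm : M 1 1 = -m := by linear_combination htr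
  rw [hm] at h01 h10 hor
  have e01 : HahnSeries.C e * laurentDer D x + HahnSeries.C (2 * q) * m =
      HahnSeries.C 2 * (xi S * x) := by
    rw [map_mul, map_ofNat]
    linear_combination h01
  have e10 : HahnSeries.C e * laurentDer D y + HahnSeries.C (2 * r) * m =
      -(HahnSeries.C 2 * (xi S * y)) := by
    rw [map_mul, map_ofNat]
    linear_combination h10
  have em : HahnSeries.C 2 * m = -(HahnSeries.C 2 * (a * m) + b * y + c * x) := by
    rw [map_ofNat]
    linear_combination hor
  -- The diagonal entry at index `n` is fixed by lower indices through `em`, since `a`, `b`, `c`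
  -- raise the index. The off-diagonal entries at `n` come from `e01` and `e10` read at `n - 1`,
  -- because multiplication by `ξ` shifts the index by one.
  have step : ∀ n : ℤ, (∀ i < n, m.coeff i = 0 ∧ x.coeff i = 0 ∧ y.coeff i = 0) →
      m.coeff n = 0 ∧ x.coeff n = 0 ∧ y.coeff n = 0 := by
    intro n ih
    obtain ⟨i1, i2, i3⟩ := ih (n - 1) (by omega)
    refine ⟨?_, ?_, ?_⟩
    · have := congrArg (fun f => HahnSeries.coeff f n) em
      simp only [HahnSeries.coeff_neg, HahnSeries.coeff_add, coeff_C_mul] at this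
      rw [coeff_mul_eq_zero_of_mem_minus ha n fun i hi => (ih i hi).1,
        coeff_mul_eq_zero_of_mem_minus hb n fun i hi => (ih i hi).2.2,
        coeff_mul_eq_zero_of_mem_minus hc n fun i hi => (ih i hi).2.1] at this
      exact h2.mul_right_eq_zero.1 (by simpa using this)
    · have := congrArg (fun f => HahnSeries.coeff f (n - 1)) e01
      simp only [HahnSeries.coeff_add, coeff_C_mul, coeff_xi_mul, laurentDer_coeff, i1, i2] at this
      exact h2.mul_right_eq_zero.1 (by simpa using this.symm)
    · have := congrArg (fun f => HahnSeries.coeff f (n - 1)) e10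
      simp only [HahnSeries.coeff_add, HahnSeries.coeff_neg, coeff_C_mul, coeff_xi_mul,
        laurentDer_coeff, i1, i3] at this
      exact h2.mul_right_eq_zero.1 (by simpa using this.symm)
  obtain ⟨N1, hN1⟩ := exists_coeff_eq_zero_of_lt m
  obtain ⟨N2, hN2⟩ := exists_coeff_eq_zero_of_lt x
  obtain ⟨N3, hN3⟩ := exists_coeff_eq_zero_of_lt y
  have key : ∀ k : ℕ, ∀ i < min N1 (min N2 N3) + k,
      m.coeff i = 0 ∧ x.coeff i = 0 ∧ y.coeff i = 0 := by
    intro k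
    induction k with
    | zero => exact fun i hi => ⟨hN1 i (by omega), hN2 i (by omega), hN3 i (by omega)⟩
    | succ k ih =>
      intro i hi
      rcases lt_or_ge i (min N1 (min N2 N3) + k) with h1 | h1
      · exact ih i h1
      · exact step i fun i' hi' => ih i' (by push_cast at hi; omega)
  have all : ∀ n, m.coeff n = 0 ∧ x.coeff n = 0 ∧ y.coeff n = 0 := fun n =>
    key (n - min N1 (min N2 N3) + 1).toNat n (by omega)
  have m0 : m = 0 := by ext n; exact (all n).1
  have x0 : x = 0 := by ext n; exact (all n).2.1
  have y0 : y = 0 := by ext n; exact (all n).2.2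
  ext1 i j
  fin_cases i <;> fin_cases j
  · exact m0
  · exact x0
  · exact y0
  · exact hm.trans (by rw [m0, neg_zero]; rfl)

end LaxBracket

/-! ### Commuting flows, evolution of the resolvent and zero curvature. -/

section Flows

variable {S : Type*} [CommRing S]

/-- A family of commuting derivations for which `e` and its inverse `e'` are constants. -/
structure IsTimeFlow (D : ℕ → S →+ S) (e e' : S) : Prop where
  leibniz : ∀ k a b, D k (a * b) = a * D k b + b * D k a
  comm : ∀ j k x, D j (D k x) = D k (D j x)
  inv : e * e' = 1
  der_e : ∀ k, D k e = 0
  der_inv : ∀ k, D k e' = 0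

namespace IsTimeFlow

variable {D : ℕ → S →+ S} {e e' : S}

theorem der_scale (h : IsTimeFlow D e e') (j k : ℕ) : D j (2 ^ k * e') = 0 := by
  have h2 : D j 2 = 0 := by exact_mod_cast map_natCast_of_leibniz (D j) (h.leibniz j) 2
  rw [h.leibniz, h.der_inv, map_pow_eq_zero_of_leibniz (D j) (h.leibniz j) h2, mul_zero, mul_zero,
    add_zero]

theorem laurent_leibniz (h : IsTimeFlow D e e') (k : ℕ) (f g : LaurentSeries S) :
    laurentDer (D k) (f * g) = f * laurentDer (D k) g + g * laurentDer (D k) f :=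
  laurentDer_mul _ (h.leibniz k) f g

theorem laurentDer_scale (h : IsTimeFlow D e e') (j k : ℕ) :
    laurentDer (D j) (HahnSeries.C (2 ^ k * e')) = 0 := by
  rw [laurentDer_C, h.der_scale, map_zero]

theorem laurentDer_two (h : IsTimeFlow D e e') (j : ℕ) :
    laurentDer (D j) (2 : LaurentSeries S) = 0 := by
  exact_mod_cast map_natCast_of_leibniz _ (h.laurent_leibniz j) 2

theorem laurentDer_scale_mul_xi_pow (h : IsTimeFlow D e e') (j k : ℕ) :
    laurentDer (D j) (HahnSeries.C (2 ^ k * e') * xi S ^ (k + 1)) = 0 := by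
  rw [h.laurent_leibniz, h.laurentDer_scale,
    map_pow_eq_zero_of_leibniz _ (h.laurent_leibniz j) (laurentDer_xi (h.leibniz j)), mul_zero,
    mul_zero, add_zero]

end IsTimeFlow

end Flows

section FlowMatrices

variable {S : Type*} [CommRing S] [Algebra ℂ S]

theorem isUnit_two_of_algebra : IsUnit (2 : S) := by
  have := (isUnit_iff_ne_zero.2 (two_ne_zero (α := ℂ))).map (algebraMap ℂ S)
  rwa [map_ofNat] at this

/-- The scaled matrix `W_k = 2^k ε⁻¹ (ξ^{k+1} R)₊`. -/
noncomputable def flowW (D : S →+ S) (e e' q r : S) (k : ℕ) :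
    Matrix (Fin 2) (Fin 2) (LaurentSeries S) :=
  (HahnSeries.C (2 ^ k * e') : LaurentSeries S) • laxV D e q r k

/-- The scaled matrix `2^k ε⁻¹ ξ^{k+1} R`. -/
noncomputable def flowP (D : S →+ S) (e e' q r : S) (k : ℕ) :
    Matrix (Fin 2) (Fin 2) (LaurentSeries S) :=
  (HahnSeries.C (2 ^ k * e') * xi S ^ (k + 1) : LaurentSeries S) • resolvent D e q r

theorem flowW_mem_plus (D : S →+ S) (e e' q r : S) (k : ℕ) (i j : Fin 2) :
    flowW D e e' q r k i j ∈ plusSubgroup S :=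
  C_mul_mem_plus _ (plusPart_mem_plus _)

theorem flowP_sub_flowW_mem_minus (D : S →+ S) (e e' q r : S) (k : ℕ) (i j : Fin 2) :
    (flowP D e e' q r k - flowW D e e' q r k) i j ∈ minusSubgroup S := by
  have : (flowP D e e' q r k - flowW D e e' q r k) i j = HahnSeries.C (2 ^ k * e') *
      (xi S ^ (k + 1) * resolvent D e q r i j -
        plusPart (xi S ^ (k + 1) * resolvent D e q r i j)) := by
    simp only [flowP, flowW, laxV, Matrix.sub_apply, Matrix.smul_apply, Matrix.map_apply,
      smul_eq_mul]
    ring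
  rw [this]
  exact C_mul_mem_minus _ (sub_plusPart_mem_minus _)

theorem det_resolvent (D : S →+ S) (hD : ∀ a b, D (a * b) = a * D b + b * D a) (e q r : S) :
    resolvent D e q r 0 1 * resolvent D e q r 1 0 =
      resolvent D e q r 1 1 * (2 - resolvent D e q r 1 1) := by
  have h := (isMatrixResolvent_iff D hD e q r _).2 rfl
  have h1 := h.det
  have h2 := h.trace
  rw [Matrix.det_fin_two] at h1
  rw [Matrix.trace_fin_two] at h2
  linear_combination resolvent D e q r 1 1 * h2 - h1

variable {D : ℕ → S →+ S} {e e' q r : S}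

/-- The defect `∂R/∂t_j - [W_j, R]` commutes with the Lax operator, is traceless and is orthogonal
to `R` under the trace form, so `eq_zero_of_laxBracket_eq_zero` forces it to vanish. -/
theorem resolvent_flow (h : IsTimeFlow D e e')
    (hsol : ∀ j, (laxU q r).map (laurentDer (D j)) =
      (HahnSeries.C (2 ^ j * e') : LaurentSeries S) •
        (-laxBracket (D 0) e q r (laxV (D 0) e q r j))) (j : ℕ) :
    (resolvent (D 0) e q r).map (laurentDer (D j)) =
      flowW (D 0) e e' q r j * resolvent (D 0) e q r -
        resolvent (D 0) e q r * flowW (D 0) e e' q r j := by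
  have hR := (isMatrixResolvent_iff (D 0) (h.leibniz 0) e q r _).2 rfl
  have hU : (laxU q r).map (laurentDer (D j)) =
      -laxBracket (D 0) e q r (flowW (D 0) e e' q r j) := by
    rw [hsol, flowW, laxBracket_smul _ (h.leibniz 0) _ _ _ (h.laurentDer_scale 0 j), smul_neg]
  refine sub_eq_zero.1 ?_
  refine eq_zero_of_laxBracket_eq_zero isUnit_two_of_algebra (D 0) e q r _ _ _
    (tailSeries_mem_minus fun i => (resCoeff (D 0) e q r i).1)
    (tailSeries_mem_minus fun i => (resCoeff (D 0) e q r i).2.1)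
    (tailSeries_mem_minus fun i => (resCoeff (D 0) e q r i).2.2) _ ?_ ?_ ?_
  -- Differentiate `[𝓛, R] = 0` along `t_j`, insert `∂𝓛/∂t_j = [W_j, 𝓛]` and use the Jacobi
  -- identity.
  · have h1 := map_laxBracket (D 0) (D j) (h.leibniz j) (h.comm j 0) (h.der_e j) q r
      (resolvent (D 0) e q r)
    rw [hR.bracket, hU] at h1
    have h0 : (0 : Matrix (Fin 2) (Fin 2) (LaurentSeries S)).map (laurentDer (D j)) = 0 := by
      ext1 i j
      simp
    rw [h0] at h1
    rw [laxBracket_sub, laxBracket_sub, laxBracket_mul _ (h.leibniz 0),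
      laxBracket_mul _ (h.leibniz 0), hR.bracket, mul_zero, zero_mul, add_zero, zero_add, h1]
    noncomm_ring
  · have h1 := congrArg (laurentDer (D j)) hR.trace
    rw [Matrix.trace_fin_two, h.laurentDer_two, map_add] at h1
    rw [Matrix.trace_sub, Matrix.trace_sub, Matrix.trace_mul_comm (flowW _ _ _ _ _ _), sub_self,
      sub_zero, Matrix.trace_fin_two]
    exact h1
  -- The trace of `R [W_j, R]` is zero, and that of `R ∂R` is `tr R ∂(tr R) - ∂(det R)`, which
  -- vanishes because trace and determinant are constant.
  · change (resolvent (D 0) e q r *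
      (_ : Matrix (Fin 2) (Fin 2) (LaurentSeries S))).trace = 0
    have h1 := congrArg (laurentDer (D j)) hR.trace
    have h2 := congrArg (laurentDer (D j)) hR.det
    have htr := hR.trace
    rw [Matrix.trace_fin_two] at htr
    rw [Matrix.trace_fin_two, h.laurentDer_two, map_add] at h1
    rw [Matrix.det_fin_two, map_sub, map_zero, h.laurent_leibniz, h.laurent_leibniz] at h2
    simp only [Matrix.trace_fin_two, Matrix.mul_apply, Fin.sum_univ_two, Matrix.sub_apply,
      Matrix.map_apply]
    linear_combination -h2 + (resolvent (D 0) e q r 0 0 + resolvent (D 0) e q r 1 1) * h1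

theorem flowP_flow (h : IsTimeFlow D e e')
    (hsol : ∀ j, (laxU q r).map (laurentDer (D j)) =
      (HahnSeries.C (2 ^ j * e') : LaurentSeries S) •
        (-laxBracket (D 0) e q r (laxV (D 0) e q r j))) (j k : ℕ) :
    (flowP (D 0) e e' q r k).map (laurentDer (D j)) =
      flowW (D 0) e e' q r j * flowP (D 0) e e' q r k -
        flowP (D 0) e e' q r k * flowW (D 0) e e' q r j := by
  rw [flowP, map_matrix_smul _ (h.laurent_leibniz j) (h.laurentDer_scale_mul_xi_pow j k),
    resolvent_flow h hsol, smul_sub, Matrix.mul_smul, Matrix.smul_mul]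

/-- The zero curvature equations `∂W_k/∂t_j - ∂W_j/∂t_k = [W_j, W_k]`. -/
theorem zero_curvature (h : IsTimeFlow D e e')
    (hsol : ∀ j, (laxU q r).map (laurentDer (D j)) =
      (HahnSeries.C (2 ^ j * e') : LaurentSeries S) •
        (-laxBracket (D 0) e q r (laxV (D 0) e q r j))) (j k : ℕ) :
    (flowW (D 0) e e' q r k).map (laurentDer (D j)) -
        (flowW (D 0) e e' q r j).map (laurentDer (D k)) =
      flowW (D 0) e e' q r j * flowW (D 0) e e' q r k -
        flowW (D 0) e e' q r k * flowW (D 0) e e' q r j := by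
  have hPj := flowP_flow h hsol k j
  have hPk := flowP_flow h hsol j k
  have hmem := flowP_sub_flowW_mem_minus (D 0) e e' q r
  have hW := flowW_mem_plus (D 0) e e' q r
  -- Both factors are scalar multiples of the same matrix `R`.
  have hcomm : flowP (D 0) e e' q r j * flowP (D 0) e e' q r k =
      flowP (D 0) e e' q r k * flowP (D 0) e e' q r j := by
    rw [flowP, flowP, Matrix.smul_mul, Matrix.smul_mul, Matrix.mul_smul, Matrix.mul_smul,
      smul_comm]
  obtain ⟨Nj, hNj⟩ : ∃ N, N = flowP (D 0) e e' q r j - flowW (D 0) e e' q r j := ⟨_, rfl⟩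
  obtain ⟨Nk, hNk⟩ : ∃ N, N = flowP (D 0) e e' q r k - flowW (D 0) e e' q r k := ⟨_, rfl⟩
  have hmj := hmem j
  have hmk := hmem k
  have hWj := hW j
  have hWk := hW k
  rw [← hNj] at hmj
  rw [← hNk] at hmk
  rw [show flowP (D 0) e e' q r j = flowW (D 0) e e' q r j + Nj by rw [hNj]; abel,
    map_matrix_add] at hPj
  rw [show flowP (D 0) e e' q r k = flowW (D 0) e e' q r k + Nk by rw [hNk]; abel,
    map_matrix_add] at hPk
  rw [show flowP (D 0) e e' q r j = flowW (D 0) e e' q r j + Nj by rw [hNj]; abel,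
    show flowP (D 0) e e' q r k = flowW (D 0) e e' q r k + Nk by rw [hNk]; abel] at hcomm
  generalize flowW (D 0) e e' q r j = Wj at *
  generalize flowW (D 0) e e' q r k = Wk at *
  -- With `P = W + N`, the evolution of the `P`'s and `[P_j, P_k] = 0` turn the curvature of the
  -- polynomial parts `W` into an expression in the negative parts `N` alone, so it lies on both
  -- sides of the splitting.
  have e1 : Wk.map (laurentDer (D j)) - Wj.map (laurentDer (D k)) - (Wj * Wk - Wk * Wj) =
      -Nk.map (laurentDer (D j)) + Nj.map (laurentDer (D k)) - (Nj * Nk - Nk * Nj) := by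
    have a1 := eq_sub_of_add_eq hPk
    have a2 := eq_sub_of_add_eq hPj
    have a3 := sub_eq_zero.2 hcomm
    rw [a1, a2, ← sub_eq_zero, ← a3]
    noncomm_ring
  refine sub_eq_zero.1 ?_
  ext1 a b
  refine eq_zero_of_mem_plus_of_mem_minus ?_ ?_
  · simp only [Matrix.sub_apply, Matrix.mul_apply, Fin.sum_univ_two, Matrix.map_apply]
    exact sub_mem (sub_mem (laurentDer_mem_plus _ (hWk _ _)) (laurentDer_mem_plus _ (hWj _ _)))
      (sub_mem (add_mem (mul_mem_plus (hWj _ _) (hWk _ _)) (mul_mem_plus (hWj _ _) (hWk _ _)))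
        (add_mem (mul_mem_plus (hWk _ _) (hWj _ _)) (mul_mem_plus (hWk _ _) (hWj _ _))))
  · rw [e1]
    simp only [Matrix.sub_apply, Matrix.add_apply, Matrix.neg_apply, Matrix.mul_apply,
      Fin.sum_univ_two, Matrix.map_apply]
    exact sub_mem (add_mem (neg_mem (laurentDer_mem_minus _ (hmk _ _)))
        (laurentDer_mem_minus _ (hmj _ _)))
      (sub_mem (add_mem (mul_mem_minus (hmj _ _) (hmk _ _)) (mul_mem_minus (hmj _ _) (hmk _ _)))
        (add_mem (mul_mem_minus (hmk _ _) (hmj _ _)) (mul_mem_minus (hmk _ _) (hmj _ _))))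

end FlowMatrices

/-! ### Coefficients of the resolvent: quotients, membership in a subalgebra, divisibility by `q`,
trace. -/

section Ratio

variable {S : Type*} [CommRing S] [Algebra ℂ S]

theorem isUnit_two_add_tailSeries (a : ℕ → S) : IsUnit (2 + tailSeries a) := by
  have : 2 + tailSeries a = HahnSeries.ofPowerSeries ℤ S
      (2 + PowerSeries.X * PowerSeries.mk a) := by
    rw [map_add, map_ofNat, tailSeries]
  rw [this]
  refine IsUnit.map _ ?_
  rw [PowerSeries.isUnit_iff_constantCoeff]
  simpa only [map_add, map_ofNat, map_mul, PowerSeries.constantCoeff_X, zero_mul, add_zero]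
    using isUnit_two_of_algebra

theorem isUnit_resolvent (D : S →+ S) (e q r : S) : IsUnit (resolvent D e q r 0 0) :=
  isUnit_two_add_tailSeries _

/-- The quotient of two series with coefficients in a subalgebra has coefficients there. -/
theorem exists_tailSeries_div (T : Subalgebra ℂ S) (a c : ℕ → S) (ha : ∀ j, a j ∈ T)
    (hc : ∀ j, c j ∈ T) :
    ∃ s : ℕ → S, (∀ j, s j ∈ T) ∧ (2 + tailSeries a) * tailSeries s = tailSeries c := by
  -- The division is carried out over `T` itself, where 2 is still invertible, and then mapped into
  -- `S`.
  have hu : IsUnit (2 + PowerSeries.X * PowerSeries.mk fun j => (⟨a j, ha j⟩ : T)) := by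
    rw [PowerSeries.isUnit_iff_constantCoeff]
    simpa only [map_add, map_ofNat, map_mul, PowerSeries.constantCoeff_X, zero_mul, add_zero]
      using isUnit_two_of_algebra (S := T)
  obtain ⟨p, hp⟩ := hu.dvd (a := PowerSeries.mk fun j => (⟨c j, hc j⟩ : T))
  refine ⟨fun j => (PowerSeries.coeff j p : T), fun j => (PowerSeries.coeff j p).2, ?_⟩
  have hp' := congrArg (PowerSeries.map (T.val : T →+* S)) hp
  have e1 : PowerSeries.map (T.val : T →+* S) (PowerSeries.mk fun j => (⟨a j, ha j⟩ : T)) =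
      PowerSeries.mk a := by
    ext j
    simp
  have e2 : PowerSeries.map (T.val : T →+* S) (PowerSeries.mk fun j => (⟨c j, hc j⟩ : T)) =
      PowerSeries.mk c := by
    ext j
    simp
  have e3 : PowerSeries.map (T.val : T →+* S) p =
      PowerSeries.mk fun j => ((PowerSeries.coeff j p : T) : S) := by
    ext j
    simp
  rw [map_mul, map_add, map_mul, e1, e2, e3, PowerSeries.map_X, map_ofNat] at hp'
  rw [tailSeries, tailSeries, tailSeries, hp', map_mul, map_mul, map_mul, map_mul, map_add,
    map_mul, map_ofNat]
  ring

/-- Needed with `T` the series over `V`: only elements of `V` are known to have a primitive in `X`.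
-/
theorem resCoeff_mem (T : Subalgebra ℂ S) (D : S →+ S) (hT : ∀ x ∈ T, D x ∈ T) {e q r : S}
    (he : e ∈ T) (hq : q ∈ T) (hr : r ∈ T) (j : ℕ) :
    (resCoeff D e q r j).1 ∈ T ∧ (resCoeff D e q r j).2.1 ∈ T ∧ (resCoeff D e q r j).2.2 ∈ T := by
  induction j using Nat.strong_induction_on with
  | _ j ih =>
    cases j with
    | zero =>
      rw [resCoeff]
      exact ⟨zero_mem _, hq, neg_mem hr⟩
    | succ j =>
      obtain ⟨h1, h2, h3⟩ := ih j (by omega)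
      have hh : algebraMap ℂ S (1 / 2) ∈ T := T.algebraMap_mem _
      have h2T : (2 : S) ∈ T := ofNat_mem T 2
      rw [resCoeff]
      refine ⟨mul_mem (neg_mem hh) (sum_mem fun i _ => ?_), ?_, ?_⟩
      · obtain ⟨k1, k2, k3⟩ := ih i (by omega)
        obtain ⟨l1, l2, l3⟩ := ih (j - i) (by omega)
        exact add_mem (mul_mem k1 l1) (mul_mem k2 l3)
      · exact mul_mem hh (add_mem (mul_mem he (hT _ h2)) (mul_mem (mul_mem h2T hq) h1))
      · exact mul_mem (neg_mem hh) (add_mem (mul_mem he (hT _ h3)) (mul_mem (mul_mem h2T hr) h1))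

/-- In the recursion for `B_j` the term `2 q A_j` is a multiple of `q`, and differentiating a
multiple of `q` gives another because `q` divides `D q`. -/
theorem dvd_resCoeff (D : S →+ S) (hD : ∀ a b, D (a * b) = a * D b + b * D a) (e q r : S)
    (hq : q ∣ D q) (j : ℕ) : q ∣ (resCoeff D e q r j).2.1 := by
  induction j with
  | zero => rw [resCoeff]
  | succ j ih =>
    rw [resCoeff]
    obtain ⟨s, hs⟩ := ih
    refine Dvd.dvd.mul_left (dvd_add (Dvd.dvd.mul_left ?_ _) ?_) _
    · rw [hs, hD]
      exact dvd_add (dvd_mul_right _ _) (Dvd.dvd.mul_left hq _)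
    · exact Dvd.dvd.mul_right (Dvd.dvd.mul_left dvd_rfl _) _

/-- This gives the entry `R₀₁` the shape required of type B, with the factor `ξ` compensating that
`R₀₁` starts at `q ξ⁻¹`. -/
theorem exists_xi_mul_resolvent (D : S →+ S) (hD : ∀ a b, D (a * b) = a * D b + b * D a)
    (e q r : S) (hq : q ∣ D q) : ∃ f : PowerSeries S, PowerSeries.constantCoeff f = 1 ∧
      xi S * resolvent D e q r 0 1 = HahnSeries.ofPowerSeries ℤ S f * HahnSeries.C q := by
  choose s hs using dvd_resCoeff D hD e q r hq
  -- The chosen `s 0` satisfies only `q = q * s 0`, so the leading coefficient is set to 1 directly.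
  refine ⟨PowerSeries.mk fun j => Nat.casesOn j 1 fun k => s (k + 1), by simp, ?_⟩
  change xi S * tailSeries _ = _
  rw [xi_mul_tailSeries_eq, ← HahnSeries.ofPowerSeries_C, ← map_mul]
  congr 1
  ext j
  rw [PowerSeries.coeff_mk, PowerSeries.coeff_mul_C, PowerSeries.coeff_mk]
  cases j with
  | zero => rw [resCoeff]; simp
  | succ j => rw [hs, mul_comm]

theorem laxV_zero_apply_zero_zero (D : S →+ S) (e q r : S) : laxV D e q r 0 0 0 = 2 * xi S := by
  change plusPart (xi S ^ (0 + 1) * (2 + tailSeries _)) = _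
  rw [pow_one, mul_add, xi_mul_tailSeries, resCoeff, map_zero, zero_add,
    plusPart_of_mem_plus_add_minus _ (tailSeries_mem_minus _), mul_comm]
  rw [mul_comm, ← map_ofNat (HahnSeries.C : S →+* LaurentSeries S)]
  exact C_mul_mem_plus _ xi_mem_plus

theorem laxV_zero_apply_zero_one (D : S →+ S) (e q r : S) :
    laxV D e q r 0 0 1 = HahnSeries.C q := by
  change plusPart (xi S ^ (0 + 1) * tailSeries _) = _
  rw [pow_one, xi_mul_tailSeries, resCoeff,
    plusPart_of_mem_plus_add_minus (C_mem_plus _) (tailSeries_mem_minus _)]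

/-- Since `tr R = 2`, the trace of `P_k` is already polynomial in `ξ` and truncation does not change
it. -/
theorem trace_flowW (D : S →+ S) (hD : ∀ a b, D (a * b) = a * D b + b * D a) (e e' q r : S)
    (k : ℕ) : flowW D e e' q r k 0 0 + flowW D e e' q r k 1 1 =
      2 * (HahnSeries.C (2 ^ k * e') * xi S ^ (k + 1)) := by
  have hm := fun i => flowP_sub_flowW_mem_minus D e e' q r k i i
  have hp := fun i => flowW_mem_plus D e e' q r k i i
  have htr := ((isMatrixResolvent_iff D hD e q r _).2 rfl).trace
  rw [Matrix.trace_fin_two] at htr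
  have hP : flowP D e e' q r k 0 0 + flowP D e e' q r k 1 1 =
      2 * (HahnSeries.C (2 ^ k * e') * xi S ^ (k + 1)) := by
    simp only [flowP, Matrix.smul_apply, smul_eq_mul]
    linear_combination HahnSeries.C (2 ^ k * e') * xi S ^ (k + 1) * htr
  rw [← hP]
  refine sub_eq_zero.1 (eq_zero_of_mem_plus_of_mem_minus ?_ ?_)
  · refine sub_mem (add_mem (hp 0) (hp 1)) ?_
    rw [hP, two_mul]
    have := C_mul_mem_plus (2 ^ k * e') (xi_pow_mem_plus (S := S) (k + 1))
    exact add_mem this this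
  · have := neg_mem (add_mem (hm 0) (hm 1))
    simp only [Matrix.sub_apply] at this
    convert this using 1
    ring

end Ratio

/-! ### The line spanned by the image of the resolvent and its logarithmic derivatives. -/

section LogDerivative

variable {S : Type*} [CommRing S] [Algebra ℂ S] {D : ℕ → S →+ S} {e e' q r : S}
  {y : LaurentSeries S}

/-- Rank one: the second column of `R` is proportional to `(1, y)` as well. -/
theorem ratio_mul_resolvent (h : IsTimeFlow D e e')
    (hy : resolvent (D 0) e q r 0 0 * y = resolvent (D 0) e q r 1 0) :
    y * resolvent (D 0) e q r 0 1 = resolvent (D 0) e q r 1 1 := by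
  have htr := ((isMatrixResolvent_iff (D 0) (h.leibniz 0) e q r _).2 rfl).trace
  have hdet := det_resolvent (D 0) (h.leibniz 0) e q r
  rw [Matrix.trace_fin_two] at htr
  refine (isUnit_resolvent (D 0) e q r).mul_left_cancel ?_
  linear_combination resolvent (D 0) e q r 0 1 * hy + hdet - resolvent (D 0) e q r 1 1 * htr

/-- The Riccati equations for the ratio of the entries of the first column of the resolvent. -/
theorem riccati (h : IsTimeFlow D e e')
    (hsol : ∀ j, (laxU q r).map (laurentDer (D j)) =
      (HahnSeries.C (2 ^ j * e') : LaurentSeries S) •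
        (-laxBracket (D 0) e q r (laxV (D 0) e q r j)))
    (hy : resolvent (D 0) e q r 0 0 * y = resolvent (D 0) e q r 1 0) (j : ℕ) :
    laurentDer (D j) y = flowW (D 0) e e' q r j 1 0 + flowW (D 0) e e' q r j 1 1 * y -
      y * (flowW (D 0) e e' q r j 0 0 + flowW (D 0) e e' q r j 0 1 * y) := by
  have hR := resolvent_flow h hsol j
  have h00 := congrFun (congrFun hR 0) 0
  have h10 := congrFun (congrFun hR 1) 0
  simp only [Matrix.map_apply, Matrix.mul_apply, Fin.sum_univ_two, Matrix.sub_apply] at h00 h10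
  have hy' := congrArg (laurentDer (D j)) hy
  rw [h.laurent_leibniz, h00, h10] at hy'
  have hb := ratio_mul_resolvent h hy
  refine (isUnit_resolvent (D 0) e q r).mul_left_cancel ?_
  linear_combination hy' + flowW (D 0) e e' q r j 1 0 * hb -
    (flowW (D 0) e e' q r j 1 1 - flowW (D 0) e e' q r j 0 0 -
      flowW (D 0) e e' q r j 0 1 * y) * hy

/-- After the Riccati equations are inserted, the difference of the two sides is the first row of
the zero curvature equation applied to `(1, y)`. -/
theorem logDer_closed (h : IsTimeFlow D e e')
    (hsol : ∀ j, (laxU q r).map (laurentDer (D j)) =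
      (HahnSeries.C (2 ^ j * e') : LaurentSeries S) •
        (-laxBracket (D 0) e q r (laxV (D 0) e q r j)))
    (hy : resolvent (D 0) e q r 0 0 * y = resolvent (D 0) e q r 1 0) (j k : ℕ) :
    laurentDer (D j) (flowW (D 0) e e' q r k 0 0 + flowW (D 0) e e' q r k 0 1 * y) =
      laurentDer (D k) (flowW (D 0) e e' q r j 0 0 + flowW (D 0) e e' q r j 0 1 * y) := by
  have hZ := zero_curvature h hsol j k
  have h00 := congrFun (congrFun hZ 0) 0
  have h01 := congrFun (congrFun hZ 0) 1
  simp only [Matrix.map_apply, Matrix.mul_apply, Fin.sum_univ_two, Matrix.sub_apply] at h00 h01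
  rw [map_add, map_add, h.laurent_leibniz, h.laurent_leibniz, riccati h hsol hy,
    riccati h hsol hy]
  linear_combination h00 + y * h01

/-- The vector `(1, y)` is an eigenvector of `R` with eigenvalue `R₀₀ + R₁₁ = 2`. Replacing `W_k` by
`P_k` thus yields exactly the subtracted term, and `P_k - W_k` contributes only negative powers. -/
theorem logDer_mem_minus (h : IsTimeFlow D e e')
    (hy : resolvent (D 0) e q r 0 0 * y = resolvent (D 0) e q r 1 0) (hym : y ∈ minusSubgroup S)
    (k : ℕ) : flowW (D 0) e e' q r k 0 0 + flowW (D 0) e e' q r k 0 1 * y -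
      2 * (HahnSeries.C (2 ^ k * e') * xi S ^ (k + 1)) ∈ minusSubgroup S := by
  have htr := ((isMatrixResolvent_iff (D 0) (h.leibniz 0) e q r _).2 rfl).trace
  rw [Matrix.trace_fin_two] at htr
  have hb := ratio_mul_resolvent h hy
  have hm := flowP_sub_flowW_mem_minus (D 0) e e' q r k 0
  have hP : flowP (D 0) e e' q r k 0 0 + flowP (D 0) e e' q r k 0 1 * y =
      2 * (HahnSeries.C (2 ^ k * e') * xi S ^ (k + 1)) := by
    simp only [flowP, Matrix.smul_apply, smul_eq_mul]
    linear_combination HahnSeries.C (2 ^ k * e') * xi S ^ (k + 1) * (htr + hb)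
  have := neg_mem (add_mem (hm 0) (mul_mem_minus (hm 1) hym))
  simp only [Matrix.sub_apply] at this
  rw [← hP]
  convert this using 1
  ring

/-- The explicit X-component shows that its coefficients lie in the subalgebra that contains those
of `q` and `y`. -/
theorem logDer_zero_eq :
    flowW (D 0) e e' q r 0 0 0 + flowW (D 0) e e' q r 0 0 1 * y -
      2 * (HahnSeries.C (2 ^ 0 * e') * xi S ^ (0 + 1)) = HahnSeries.C (e' * q) * y := by
  simp only [flowW, Matrix.smul_apply, smul_eq_mul, laxV_zero_apply_zero_zero,
    laxV_zero_apply_zero_one, map_mul, pow_zero, one_mul]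
  ring

end LogDerivative

/-! ### The linear system: two solutions, their determinants, and uniqueness. -/

section WaveSolutions

variable {S : Type*} [CommRing S] [Algebra ℂ S]

/-- The wave equations for the vector `(x exp (n α), w exp (n α))ᵀ`. -/
def IsWaveSolution (D : ℕ → S →+ S) (e e' q r : S) (n : ℤ) (x w : LaurentSeries S) : Prop :=
  ∀ k : ℕ,
    laurentDer (D k) x + (n : LaurentSeries S) * (HahnSeries.C (2 ^ k * e') * xi S ^ (k + 1)) * x =
      flowW (D 0) e e' q r k 0 0 * x + flowW (D 0) e e' q r k 0 1 * w -
        HahnSeries.C (2 ^ k * e') * xi S ^ (k + 1) * x ∧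
    laurentDer (D k) w + (n : LaurentSeries S) * (HahnSeries.C (2 ^ k * e') * xi S ^ (k + 1)) * w =
      flowW (D 0) e e' q r k 1 0 * x + flowW (D 0) e e' q r k 1 1 * w -
        HahnSeries.C (2 ^ k * e') * xi S ^ (k + 1) * w

variable {D : ℕ → S →+ S} {e e' q r : S} {n m : ℤ} {x w x' w' y : LaurentSeries S}

/-- The coefficient 2 in the hypothesis on `φ` has two sources: one copy of `2^k ε⁻¹ ξ^{k+1}` comes
from the derivative of `exp α`, the other from the term `-ξ^{k+1} I` of the system. -/
theorem isWaveSolution_first (h : IsTimeFlow D e e')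
    (hsol : ∀ j, (laxU q r).map (laurentDer (D j)) =
      (HahnSeries.C (2 ^ j * e') : LaurentSeries S) •
        (-laxBracket (D 0) e q r (laxV (D 0) e q r j)))
    (hy : resolvent (D 0) e q r 0 0 * y = resolvent (D 0) e q r 1 0) {φ : LaurentSeries S}
    (hφ : ∀ k, laurentDer (D k) φ = (flowW (D 0) e e' q r k 0 0 + flowW (D 0) e e' q r k 0 1 * y -
      2 * (HahnSeries.C (2 ^ k * e') * xi S ^ (k + 1))) * φ) :
    IsWaveSolution D e e' q r 1 φ (φ * y) := by
  intro k
  rw [h.laurent_leibniz, riccati h hsol hy, hφ]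
  push_cast
  constructor <;> ring

/-- The vector `(R₀₁, -R₀₀)` spans the kernel of `R`, a line which the flows `∂R/∂t_k = [W_k, R]`
preserve. The scalar `φ⁻¹` corrects its growth; the factor `ξ` is constant and normalises the
leading term. -/
theorem isWaveSolution_second (h : IsTimeFlow D e e')
    (hsol : ∀ j, (laxU q r).map (laurentDer (D j)) =
      (HahnSeries.C (2 ^ j * e') : LaurentSeries S) •
        (-laxBracket (D 0) e q r (laxV (D 0) e q r j)))
    (hy : resolvent (D 0) e q r 0 0 * y = resolvent (D 0) e q r 1 0) {φ ψ : LaurentSeries S}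
    (hφ : ∀ k, laurentDer (D k) φ = (flowW (D 0) e e' q r k 0 0 + flowW (D 0) e e' q r k 0 1 * y -
      2 * (HahnSeries.C (2 ^ k * e') * xi S ^ (k + 1))) * φ) (hψ : φ * ψ = 1) :
    IsWaveSolution D e e' q r (-1) (ψ * (xi S * resolvent (D 0) e q r 0 1))
      (-(ψ * (xi S * resolvent (D 0) e q r 0 0))) := by
  intro k
  have hR := resolvent_flow h hsol k
  have h00 := congrFun (congrFun hR 0) 0
  have h01 := congrFun (congrFun hR 0) 1
  simp only [Matrix.map_apply, Matrix.mul_apply, Fin.sum_univ_two, Matrix.sub_apply] at h00 h01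
  have hW := trace_flowW (D 0) (h.leibniz 0) e e' q r k
  have htr := ((isMatrixResolvent_iff (D 0) (h.leibniz 0) e q r _).2 rfl).trace
  rw [Matrix.trace_fin_two] at htr
  have hb := ratio_mul_resolvent h hy
  have hψ' : laurentDer (D k) ψ = -(flowW (D 0) e e' q r k 0 0 +
      flowW (D 0) e e' q r k 0 1 * y -
      2 * (HahnSeries.C (2 ^ k * e') * xi S ^ (k + 1))) * ψ := by
    have h1 := congrArg (laurentDer (D k)) hψ
    rw [h.laurent_leibniz, hφ, map_one_of_leibniz _ (h.laurent_leibniz k)] at h1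
    linear_combination ψ * h1 - (laurentDer (D k) ψ + (flowW (D 0) e e' q r k 0 0 +
      flowW (D 0) e e' q r k 0 1 * y -
      2 * (HahnSeries.C (2 ^ k * e') * xi S ^ (k + 1))) * ψ) * hψ
  rw [map_neg, h.laurent_leibniz, h.laurent_leibniz, h.laurent_leibniz, h.laurent_leibniz,
    laurentDer_xi (h.leibniz k), hψ', h00, h01]
  push_cast
  constructor
  · linear_combination (-ψ * xi S * flowW (D 0) e e' q r k 0 1) * hb -
      ψ * xi S * resolvent (D 0) e q r 0 1 * hW
  · linear_combination ψ * xi S * flowW (D 0) e e' q r k 0 1 * hy +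
      ψ * xi S * resolvent (D 0) e q r 0 0 * hW

/-- As `y R₀₁ = R₁₁`, the determinant collapses to `-ξ tr R`. -/
theorem det_of_ratio (h : IsTimeFlow D e e')
    (hy : resolvent (D 0) e q r 0 0 * y = resolvent (D 0) e q r 1 0) {φ ψ : LaurentSeries S}
    (hψ : φ * ψ = 1) :
    φ * -(ψ * (xi S * resolvent (D 0) e q r 0 0)) -
      φ * y * (ψ * (xi S * resolvent (D 0) e q r 0 1)) = -2 * xi S := by
  have htr := ((isMatrixResolvent_iff (D 0) (h.leibniz 0) e q r _).2 rfl).trace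
  rw [Matrix.trace_fin_two] at htr
  have hb := ratio_mul_resolvent h hy
  linear_combination -xi S * (resolvent (D 0) e q r 0 0 + y * resolvent (D 0) e q r 0 1) * hψ -
    xi S * hb - xi S * htr

/-- Liouville's formula: subtracting `ξ^{k+1} I` makes the system trace free, so only the
exponential factors contribute. -/
theorem IsWaveSolution.der_det (h : IsTimeFlow D e e') (h1 : IsWaveSolution D e e' q r n x w)
    (h2 : IsWaveSolution D e e' q r m x' w') (k : ℕ) :
    laurentDer (D k) (x * w' - w * x') +
      ((n + m : ℤ) : LaurentSeries S) * (HahnSeries.C (2 ^ k * e') * xi S ^ (k + 1)) *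
        (x * w' - w * x') = 0 := by
  obtain ⟨a1, a2⟩ := h1 k
  obtain ⟨b1, b2⟩ := h2 k
  have hW := trace_flowW (D 0) (h.leibniz 0) e e' q r k
  rw [map_sub, h.laurent_leibniz, h.laurent_leibniz]
  push_cast
  linear_combination w' * a1 + x * b2 - x' * a2 - w * b1 + (x * w' - w * x') * hW

/-- The term with `ξ` has invertible coefficient `N e'` and raises the power of `ξ`, so at the top
power of `f` the derivative cannot cancel it. -/
theorem eq_zero_of_der_add (h : IsTimeFlow D e e') {N : ℤ} (hN : N ≠ 0) {f : LaurentSeries S}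
    (hf : laurentDer (D 0) f +
      (N : LaurentSeries S) * (HahnSeries.C (2 ^ 0 * e') * xi S ^ (0 + 1)) * f = 0) : f = 0 := by
  have hu : IsUnit ((N : S) * e') := by
    refine IsUnit.mul ?_ (IsUnit.of_mul_eq_one e (by rw [mul_comm]; exact h.inv))
    have := (isUnit_iff_ne_zero.2 (Int.cast_ne_zero.2 hN : (N : ℂ) ≠ 0)).map (algebraMap ℂ S)
    rwa [map_intCast] at this
  refine eq_zero_of_forall_coeff f fun n ih => ?_
  have e1 : laurentDer (D 0) f + HahnSeries.C ((N : S) * e') * (xi S * f) = 0 := by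
    rw [← hf, map_mul, map_intCast]
    simp only [pow_zero, one_mul, zero_add, pow_one]
    ring
  have := congrArg (fun g => HahnSeries.coeff g (n - 1)) e1
  simp only [HahnSeries.coeff_add, laurentDer_coeff, coeff_C_mul, coeff_xi_mul,
    ih (n - 1) (by omega), map_zero, zero_add, sub_add_cancel, HahnSeries.coeff_zero] at this
  exact hu.mul_right_eq_zero.1 this

theorem IsWaveSolution.const_mul (h : IsTimeFlow D e e') (h1 : IsWaveSolution D e e' q r n x w)
    {g : LaurentSeries S} (hg : ∀ k, laurentDer (D k) g = 0) :
    IsWaveSolution D e e' q r n (g * x) (g * w) := by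
  intro k
  obtain ⟨a1, a2⟩ := h1 k
  rw [h.laurent_leibniz, h.laurent_leibniz, hg]
  constructor
  · linear_combination g * a1
  · linear_combination g * a2

/-- Two normalised pairs of solutions differ by mutually inverse constants. -/
theorem exists_const_of_det (h : IsTimeFlow D e e') {xA wA xB wB xA' wA' xB' wB' : LaurentSeries S}
    (hA : IsWaveSolution D e e' q r 1 xA wA) (hB : IsWaveSolution D e e' q r (-1) xB wB)
    (hd : xA * wB - wA * xB = -2 * xi S)
    (hA' : IsWaveSolution D e e' q r 1 xA' wA') (hB' : IsWaveSolution D e e' q r (-1) xB' wB')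
    (hd' : xA' * wB' - wA' * xB' = -2 * xi S) :
    ∃ g g' : LaurentSeries S, (∀ k, laurentDer (D k) g = 0) ∧ g * g' = 1 ∧ xA' = g * xA ∧
      xB' = g' * xB := by
  have hu : IsUnit (-2 * xi S) := by
    refine IsUnit.mul ?_ isUnit_xi
    have := ((isUnit_two_of_algebra (S := S)).map (HahnSeries.C : S →+* LaurentSeries S)).neg
    rwa [map_ofNat] at this
  -- Two solutions of the same type have exponents adding up to 2 or -2, so their determinant
  -- vanishes.
  have h0 : xA * wA' - wA * xA' = 0 :=
    eq_zero_of_der_add h (N := 1 + 1) (by norm_num) (hA.der_det h hA' 0)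
  have h0' : xB * wB' - wB * xB' = 0 :=
    eq_zero_of_der_add h (N := -1 + -1) (by norm_num) (hB.der_det h hB' 0)
  -- Cramer's rule in the basis of the first pair: the vanishing determinants leave a single
  -- coordinate for each new solution.
  obtain ⟨g, hg⟩ := hu.dvd (a := xA' * wB - wA' * xB)
  obtain ⟨g', hg'⟩ := hu.dvd (a := xA * wB' - wA * xB')
  have e1 : xA' = g * xA := hu.mul_left_cancel <| by
    linear_combination -xA' * hd + xA * hg + xB * h0
  have e2 : wA' = g * wA := hu.mul_left_cancel <| by
    linear_combination -wA' * hd + wA * hg + wB * h0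
  have e3 : xB' = g' * xB := hu.mul_left_cancel <| by
    linear_combination -xB' * hd + xB * hg' - xA * h0'
  have e4 : wB' = g' * wB := hu.mul_left_cancel <| by
    linear_combination -wB' * hd + wB * hg' - wA * h0'
  refine ⟨g, g', fun k => ?_, ?_, e1, e3⟩
  -- For solutions of opposite types the exponents cancel, so the determinant defining `g` is
  -- constant.
  · have := hA'.der_det h hB k
    rw [hg, h.laurent_leibniz, h.laurent_leibniz, laurentDer_xi (h.leibniz k), map_neg,
      h.laurentDer_two] at this
    refine hu.mul_right_eq_zero.1 ?_
    push_cast at this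
    linear_combination this
  · refine hu.mul_left_cancel ?_
    rw [e1, e2, e3, e4] at hd'
    linear_combination hd' - g * g' * hd

end WaveSolutions

/-! ### Exponentials of power series in `ξ⁻¹`. -/

section PowerDerivation

variable {S : Type*} [CommRing S]

theorem laurentDer_ofPowerSeries (D : S →+ S) (f : PowerSeries S) :
    laurentDer D (HahnSeries.ofPowerSeries ℤ S f) =
      HahnSeries.ofPowerSeries ℤ S (powerDer D f : MvPowerSeries Unit S) := by
  ext n
  rw [laurentDer_coeff, PowerSeries.coeff_coe, PowerSeries.coeff_coe]
  split_ifs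
  · exact map_zero D
  · rfl

theorem coeff_powerDer (D : S →+ S) (f : PowerSeries S) (n : ℕ) :
    PowerSeries.coeff n (powerDer D f : MvPowerSeries Unit S) = D (PowerSeries.coeff n f) := rfl

end PowerDerivation

section Exponential

variable {S : Type*} [CommRing S] [Algebra ℂ S]

theorem isUnit_natCast_of_ne_zero {n : ℕ} (hn : n ≠ 0) : IsUnit (n : S) := by
  have := (isUnit_iff_ne_zero.2 (Nat.cast_ne_zero.2 hn : (n : ℂ) ≠ 0)).map (algebraMap ℂ S)
  rwa [map_natCast] at this

/-- Uniqueness for a linear differential equation in the formal variable: the coefficient at `n + 1`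
is determined by lower ones since `n + 1` is invertible. -/
theorem powerSeries_eq_zero_of_derivative {u v : PowerSeries S}
    (h : PowerSeries.derivative S u = v * u) (h0 : PowerSeries.constantCoeff u = 0) : u = 0 := by
  ext n
  rw [map_zero]
  induction n using Nat.strong_induction_on with
  | _ n ih =>
    cases n with
    | zero => simpa using h0
    | succ n =>
      have h1 := congrArg (PowerSeries.coeff n) h
      rw [PowerSeries.coeff_mul, PowerSeries.coeff_derivative, Finset.sum_eq_zero] at h1
      · have hu := isUnit_natCast_of_ne_zero (S := S) n.succ_ne_zero
        push_cast at hu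
        exact hu.mul_left_eq_zero.1 h1
      · intro p hp
        have := Finset.HasAntidiagonal.mem_antidiagonal.1 hp
        rw [ih p.2 (by omega), mul_zero]

/-- The coefficients of the exponential of `∑ i, σ i X ^ (i + 1)`. -/
noncomputable def expCoeff (σ : ℕ → S) : ℕ → S
  | 0 => 1
  | n + 1 => algebraMap ℂ S (1 / (n + 1)) *
      ∑ i : Fin (n + 1), (i + 1) * σ i * expCoeff σ (n - i)
  termination_by n => n
  decreasing_by all_goals omega

theorem derivative_mk_expCoeff (σ : ℕ → S) :
    PowerSeries.derivative S (PowerSeries.mk (expCoeff σ)) =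
      PowerSeries.derivative S (PowerSeries.X * PowerSeries.mk σ) *
        PowerSeries.mk (expCoeff σ) := by
  ext n
  have hn : algebraMap ℂ S (1 / (n + 1)) * (n + 1) = 1 := by
    have : ((n : S) + 1) = algebraMap ℂ S (n + 1) := by simp
    rw [this, ← map_mul, one_div, inv_mul_cancel₀ (by exact_mod_cast n.succ_ne_zero), map_one]
  rw [PowerSeries.coeff_derivative, PowerSeries.coeff_mk, expCoeff, PowerSeries.coeff_mul,
    Finset.Nat.sum_antidiagonal_eq_sum_range_succ_mk, Finset.sum_range, mul_right_comm, hn, one_mul]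
  refine Finset.sum_congr rfl fun i _ => ?_
  rw [PowerSeries.coeff_derivative, PowerSeries.coeff_succ_X_mul, PowerSeries.coeff_mk,
    PowerSeries.coeff_mk]
  ring

/-- Every series `∑ i, σ i ξ^{-(i+1)}` has an exponential. -/
theorem exists_exp (σ : ℕ → S) : ∃ φ : PowerSeries S, PowerSeries.constantCoeff φ = 1 ∧
    ∀ D : S →+ S, (∀ a b, D (a * b) = a * D b + b * D a) →
      laurentDer D (HahnSeries.ofPowerSeries ℤ S φ) =
        tailSeries (fun i => D (σ i)) * HahnSeries.ofPowerSeries ℤ S φ := by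
  refine ⟨PowerSeries.mk (expCoeff σ), by simp [expCoeff], fun D hD => ?_⟩
  have hcomm : ∀ f : PowerSeries S, PowerSeries.derivative S (powerDer D f : MvPowerSeries Unit S) =
      (powerDer D (PowerSeries.derivative S f) : MvPowerSeries Unit S) := by
    intro f
    ext n
    rw [coeff_powerDer, PowerSeries.coeff_derivative, PowerSeries.coeff_derivative, coeff_powerDer,
      hD]
    have := map_natCast_of_leibniz D hD (n + 1)
    push_cast at this
    rw [this]
    ring
  have hmul : ∀ f g : PowerSeries S, (powerDer D (f * g) : MvPowerSeries Unit S) =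
      f * (powerDer D g : MvPowerSeries Unit S) + g * (powerDer D f : MvPowerSeries Unit S) :=
    powerDer_mul D hD
  have hd := derivative_mk_expCoeff σ
  have hσ : (powerDer D (PowerSeries.X * PowerSeries.mk σ : PowerSeries S) :
      MvPowerSeries Unit S) = (PowerSeries.X * PowerSeries.mk fun i => D (σ i) : PowerSeries S) := by
    change (_ : PowerSeries S) = _
    ext n
    rw [coeff_powerDer]
    cases n with
    | zero => simp
    | succ n => simp [PowerSeries.coeff_succ_X_mul]
  have h0 : PowerSeries.constantCoeff (PowerSeries.mk (expCoeff σ)) = 1 := by simp [expCoeff]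
  generalize PowerSeries.mk (expCoeff σ) = φ at hd h0 ⊢
  generalize PowerSeries.X * PowerSeries.mk σ = τ at hd hσ
  rw [tailSeries, ← map_mul, laurentDer_ofPowerSeries]
  congr 1
  rw [← hσ, ← sub_eq_zero]
  -- The formal derivative in `ξ⁻¹` commutes with `D`, so `u = D φ - (D τ) φ` satisfies `u' = τ' u`
  -- with zero constant term.
  refine powerSeries_eq_zero_of_derivative (v := PowerSeries.derivative S τ) ?_ ?_
  · have h1 := hcomm φ
    have h2 := hcomm τ
    rw [hd, hmul] at h1
    rw [map_sub, h1, Derivation.leibniz, h2, hd]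
    simp only [smul_eq_mul]
    ring
  · have e1 : PowerSeries.constantCoeff (powerDer D φ : MvPowerSeries Unit S) = 0 := by
      rw [← PowerSeries.coeff_zero_eq_constantCoeff_apply, coeff_powerDer,
        PowerSeries.coeff_zero_eq_constantCoeff_apply, h0, map_one_of_leibniz D hD]
    have e2 : PowerSeries.constantCoeff (powerDer D τ : MvPowerSeries Unit S) = 0 := by
      rw [hσ]
      simp
    rw [map_sub, map_mul, e1, e2, zero_mul, sub_zero]

end Exponential

/-! ### Integration of closed forms and the constants of the time derivations. -/

section TimeRing

variable {A : Type*} [CommRing A] [Algebra ℂ A]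

theorem coeff_timeDer_zero (δ : Derivation ℂ A A) (f : TimeRing A) (m : ℕ →₀ ℕ) :
    MvPowerSeries.coeff m (timeDer δ 0 f) =
      laurentDer δ.toLinearMap.toAddMonoidHom (MvPowerSeries.coeff m f) := rfl

theorem coeff_timeDer_succ (δ : Derivation ℂ A A) (k : ℕ) (f : TimeRing A) (m : ℕ →₀ ℕ) :
    MvPowerSeries.coeff m (timeDer δ (k + 1) f) =
      MvPowerSeries.coeff (m + Finsupp.single k 1) f * (m k + 1) :=
  MvPowerSeries.coeff_pderiv _ _

theorem timeDer_zero_succ_comm (δ : Derivation ℂ A A) (k : ℕ) (f : TimeRing A) :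
    timeDer δ 0 (timeDer δ (k + 1) f) = timeDer δ (k + 1) (timeDer δ 0 f) := by
  ext1 m
  rw [coeff_timeDer_zero, coeff_timeDer_succ, coeff_timeDer_succ, coeff_timeDer_zero,
    mul_comm, mul_comm _ ((m k : LaurentSeries A) + 1), ← Nat.cast_succ, ← nsmul_eq_mul,
    ← nsmul_eq_mul, map_nsmul]

theorem timeDer_succ_succ_comm (δ : Derivation ℂ A A) (j k : ℕ) (f : TimeRing A) :
    timeDer δ (j + 1) (timeDer δ (k + 1) f) = timeDer δ (k + 1) (timeDer δ (j + 1) f) := by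
  rcases eq_or_ne j k with rfl | hjk
  · rfl
  ext1 m
  simp only [coeff_timeDer_succ, Finsupp.add_apply, Finsupp.single_eq_of_ne hjk,
    Finsupp.single_eq_of_ne hjk.symm, add_zero]
  rw [add_right_comm]
  ring

theorem timeDer_C (δ : Derivation ℂ A A) (k : ℕ) {x : LaurentSeries A}
    (hx : laurentDer δ.toLinearMap.toAddMonoidHom x = 0) :
    timeDer δ k (MvPowerSeries.C x) = 0 := by
  classical
  cases k with
  | zero =>
    ext1 m
    rw [coeff_timeDer_zero, MvPowerSeries.coeff_C]
    split_ifs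
    · rw [hx, map_zero]
    · rw [map_zero, map_zero]
  | succ k =>
    ext1 m
    rw [coeff_timeDer_succ, MvPowerSeries.coeff_add_single_C, zero_mul, map_zero]

theorem laurentDer_single_one (δ : Derivation ℂ A A) (n : ℤ) :
    laurentDer δ.toLinearMap.toAddMonoidHom (HahnSeries.single n 1) = 0 := by
  ext i
  rw [laurentDer_coeff]
  by_cases h : i = n
  · subst h; simp
  · rw [HahnSeries.coeff_single_of_ne h, map_zero]; rfl

theorem isTimeFlow_timeDer (δ : Derivation ℂ A A) :
    IsTimeFlow (timeDer δ) (eps A) (epsInv A) where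
  leibniz := timeDer_mul δ
  comm j k x := by
    rcases j with _ | j <;> rcases k with _ | k
    · rfl
    · exact timeDer_zero_succ_comm δ k x
    · exact (timeDer_zero_succ_comm δ j x).symm
    · exact timeDer_succ_succ_comm δ j k x
  inv := by
    rw [eps, epsInv, ← map_mul, HahnSeries.single_mul_single]
    simp
  der_e k := timeDer_C δ k (laurentDer_single_one δ 1)
  der_inv k := timeDer_C δ k (laurentDer_single_one δ (-1))

/-- A closed form in the times is exact if its restriction to `t₁ = t₂ = ⋯ = 0` can be
integrated. -/
theorem exists_potential (δ : Derivation ℂ A A) (ω : ℕ → TimeRing A)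
    (hω : ∀ j k, timeDer δ j (ω k) = timeDer δ k (ω j))
    (h0 : ∀ n, ∃ b, δ b = (MvPowerSeries.coeff 0 (ω 0)).coeff n) :
    ∃ σ : TimeRing A, ∀ k, timeDer δ k σ = ω k := by
  classical
  obtain ⟨s, hs⟩ : ∃ s : LaurentSeries A,
      laurentDer δ.toLinearMap.toAddMonoidHom s = MvPowerSeries.coeff 0 (ω 0) := by
    choose b hb using h0
    -- Primitives of zero coefficients are set to zero, as arbitrary constants there could destroy
    -- the well-ordered support.
    refine ⟨⟨fun n => if (MvPowerSeries.coeff 0 (ω 0)).coeff n = 0 then 0 else b n,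
      (MvPowerSeries.coeff 0 (ω 0)).isPWO_support.mono fun n hn => ?_⟩, ?_⟩
    · intro h
      exact hn (if_pos h)
    · ext n
      rw [laurentDer_coeff]
      change δ (if _ then _ else _) = _
      split_ifs with h
      · rw [map_zero, h]
      · exact hb n
  -- Each variable occurring in the monomial `m` prescribes the coefficient of the potential at `m`;
  -- closedness makes these prescriptions agree.
  have hex : ∀ m : ℕ →₀ ℕ, ∃ z : LaurentSeries A, (m = 0 → z = s) ∧ ∀ i l,
      m = l + Finsupp.single i 1 → z * (l i + 1) = MvPowerSeries.coeff l (ω (i + 1)) := by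
    intro m
    by_cases hm : m = 0
    · refine ⟨s, fun _ => rfl, fun i l h => ?_⟩
      have := DFunLike.congr_fun (hm.symm.trans h) i
      simp at this
    · obtain ⟨i, hi⟩ := Finsupp.ne_iff.1 hm
      have hsub : ∀ i, m i ≠ 0 → m = m - Finsupp.single i 1 + Finsupp.single i 1 := by
        intro i hi
        rw [tsub_add_cancel_of_le]
        rw [Finsupp.single_le_iff]
        exact Nat.one_le_iff_ne_zero.2 hi
      have hl := hsub i hi
      set l := m - Finsupp.single i 1
      have hu := isUnit_natCast_of_ne_zero (S := LaurentSeries A) (l i).succ_ne_zero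
      push_cast at hu
      obtain ⟨z, hz⟩ := hu.dvd (a := MvPowerSeries.coeff l (ω (i + 1)))
      refine ⟨z, fun h => absurd h hm, fun j l' hl' => ?_⟩
      rcases eq_or_ne j i with rfl | hji
      · obtain rfl : l' = l := add_right_cancel (hl'.symm.trans hl)
        rw [hz, mul_comm]
      · have hl'i : l' i = l i + 1 := by
          have := DFunLike.congr_fun (hl'.symm.trans hl) i
          simpa [Finsupp.single_eq_of_ne hji.symm] using this
        obtain ⟨t, rfl⟩ : ∃ t, l' = t + Finsupp.single i 1 := by
          refine ⟨l' - Finsupp.single i 1, (tsub_add_cancel_of_le ?_).symm⟩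
          rw [Finsupp.single_le_iff]
          omega
        have hlt : l = t + Finsupp.single j 1 := by
          have := hl.symm.trans hl'
          rw [add_right_comm] at this
          exact add_right_cancel this
        have hc := congrArg (MvPowerSeries.coeff t) (hω (i + 1) (j + 1))
        rw [coeff_timeDer_succ, coeff_timeDer_succ, ← hlt, hz] at hc
        have e1 : l i = t i := by
          rw [hlt]; simp [Finsupp.single_eq_of_ne hji.symm]
        have e2 : (t + Finsupp.single i 1 : ℕ →₀ ℕ) j = t j := by
          simp [Finsupp.single_eq_of_ne hji]
        rw [e1] at hc hu
        rw [e2]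
        refine hu.mul_left_cancel ?_
        linear_combination -hc
  choose f hf0 hf using hex
  obtain ⟨σ, hσ⟩ : ∃ σ : TimeRing A, ∀ m, MvPowerSeries.coeff m σ = f m := ⟨f, fun _ => rfl⟩
  refine ⟨σ, fun k => ?_⟩
  cases k with
  | succ i =>
    ext1 l
    rw [coeff_timeDer_succ, hσ]
    exact hf _ i l rfl
  | zero =>
    ext1 m
    rw [coeff_timeDer_zero, hσ]
    by_cases hm : m = 0
    · rw [hf0 m hm, hs, hm]
    · obtain ⟨i, hi⟩ := Finsupp.ne_iff.1 hm
      obtain ⟨l, rfl⟩ : ∃ l, m = l + Finsupp.single i 1 := by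
        refine ⟨m - Finsupp.single i 1, (tsub_add_cancel_of_le ?_).symm⟩
        rw [Finsupp.single_le_iff]
        exact Nat.one_le_iff_ne_zero.2 hi
      -- Away from zero times the X-equation follows from the equation for `t_{i+1}` by closedness,
      -- after division by an invertible integer.
      have h1 := congrArg (laurentDer δ.toLinearMap.toAddMonoidHom) (hf _ i l rfl)
      rw [← coeff_timeDer_zero, hω 0 (i + 1), coeff_timeDer_succ, mul_comm, ← Nat.cast_succ,
        ← nsmul_eq_mul, map_nsmul, nsmul_eq_mul, mul_comm] at h1
      exact (isUnit_natCast_of_ne_zero (l i).succ_ne_zero).mul_right_cancel h1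

/-- The series all of whose coefficients lie in a subalgebra `V`. -/
def timeSubalgebra (V : Subalgebra ℂ A) : Subalgebra ℂ (TimeRing A) where
  carrier := {f | ∀ m n, (MvPowerSeries.coeff m f).coeff n ∈ V}
  mul_mem' {f g} hf hg m n := by
    classical
    rw [MvPowerSeries.coeff_mul, HahnSeries.coeff_sum]
    refine sum_mem fun p _ => ?_
    rw [HahnSeries.coeff_mul]
    exact sum_mem fun i _ => mul_mem (hf _ _) (hg _ _)
  add_mem' {f g} hf hg m n := by
    rw [map_add, HahnSeries.coeff_add]
    exact add_mem (hf m n) (hg m n)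
  algebraMap_mem' c m n := by
    classical
    rw [MvPowerSeries.algebraMap_apply, MvPowerSeries.coeff_C]
    split_ifs
    · rw [HahnSeries.algebraMap_apply', PowerSeries.algebraMap_apply, HahnSeries.ofPowerSeries_C,
        HahnSeries.C_apply, HahnSeries.coeff_single]
      split_ifs
      · exact V.algebraMap_mem c
      · exact zero_mem V
    · exact zero_mem V

theorem C_single_mem_timeSubalgebra (V : Subalgebra ℂ A) (k : ℤ) :
    (MvPowerSeries.C (HahnSeries.single k 1) : TimeRing A) ∈ timeSubalgebra V := by
  classical
  intro m n
  rw [MvPowerSeries.coeff_C]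
  split_ifs
  · rw [HahnSeries.coeff_single]
    split_ifs
    · exact one_mem V
    · exact zero_mem V
  · exact zero_mem V

/-- The embedding of `ℂ((ε))` into `A((ε))[[t₁, t₂, …]]`. -/
noncomputable def constHom (A : Type*) [CommRing A] [Algebra ℂ A] :
    LaurentSeries ℂ →+* TimeRing A :=
  (MvPowerSeries.C : LaurentSeries A →+* TimeRing A).comp
    { toFun := fun f => f.map (algebraMap ℂ A)
      map_one' := by
        ext n
        by_cases h : n = 0
        · subst h; simp
        · simp [HahnSeries.coeff_one, h]
      map_zero' := by ext n; simp
      map_add' := fun f g => by ext n; simp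
      map_mul' := fun f g => by
        ext n
        exact congrArg (fun h => HahnSeries.coeff h n)
          (HahnSeries.map_mul (algebraMap ℂ A : ℂ →ₙ+* A)) }

theorem constHom_apply (f : LaurentSeries ℂ) :
    constHom A f = MvPowerSeries.C (f.map (algebraMap ℂ A)) := rfl

theorem timeDer_constHom (δ : Derivation ℂ A A) (k : ℕ) (f : LaurentSeries ℂ) :
    timeDer δ k (constHom A f) = 0 := by
  refine timeDer_C δ k ?_
  ext n
  exact δ.map_algebraMap _

/-- The common constants of all time derivations are the elements of `ℂ((ε))`. -/
theorem exists_eq_constHom (δ : Derivation ℂ A A)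
    (hconst : ∀ a : A, δ a = 0 → a ∈ (algebraMap ℂ A).range) (f : TimeRing A)
    (hf : ∀ k, timeDer δ k f = 0) : ∃ g, f = constHom A g := by
  classical
  have h0 : ∀ n, ∃ c, algebraMap ℂ A c = (MvPowerSeries.coeff 0 f).coeff n := by
    intro n
    refine hconst _ ?_
    have := congrArg (fun g => (MvPowerSeries.coeff 0 g).coeff n) (hf 0)
    simpa [coeff_timeDer_zero, laurentDer_coeff] using this
  choose c hc using h0
  refine ⟨⟨fun n => if (MvPowerSeries.coeff 0 f).coeff n = 0 then 0 else c n,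
    (MvPowerSeries.coeff 0 f).isPWO_support.mono fun n hn => ?_⟩, ?_⟩
  · intro h
    exact hn (if_pos h)
  · ext1 m
    rw [constHom_apply, MvPowerSeries.coeff_C]
    split_ifs with hm
    · ext n
      rw [HahnSeries.map_coeff, hm]
      change _ = algebraMap ℂ A (if _ then _ else _)
      split_ifs with h
      · rw [map_zero, h]
      · exact (hc n).symm
    · obtain ⟨i, hi⟩ := Finsupp.ne_iff.1 hm
      obtain ⟨l, rfl⟩ : ∃ l, m = l + Finsupp.single i 1 := by
        refine ⟨m - Finsupp.single i 1, (tsub_add_cancel_of_le ?_).symm⟩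
        rw [Finsupp.single_le_iff]
        exact Nat.one_le_iff_ne_zero.2 hi
      have h1 := congrArg (MvPowerSeries.coeff l) (hf (i + 1))
      rw [coeff_timeDer_succ, map_zero, ← Nat.cast_succ] at h1
      exact (isUnit_natCast_of_ne_zero (l i).succ_ne_zero).mul_left_eq_zero.1 h1

end TimeRing

/-! ### Translation from the wave ring to Laurent series. -/

section WaveRing

variable {A : Type*} [CommRing A]

theorem coeff_laurentC_mul_T {R : Type*} [CommRing R] (x : R) (n m : ℤ) :
    (LaurentPolynomial.C x * LaurentPolynomial.T n : R[T;T⁻¹]).coeff m =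
      if n = m then x else 0 := by
  rw [← LaurentPolynomial.single_eq_C_mul_T, AddMonoidAlgebra.coeff_single, Finsupp.single_apply]

theorem coeff_laurentC_mul {R : Type*} [CommRing R] (x : R) (f : R[T;T⁻¹]) (m : ℤ) :
    (LaurentPolynomial.C x * f).coeff m = x * f.coeff m := by
  rw [← LaurentPolynomial.smul_eq_C_mul]
  rfl

theorem laurentC_mul_T_inj {R : Type*} [CommRing R] {x y : R} {n : ℤ} :
    (LaurentPolynomial.C x * LaurentPolynomial.T n : R[T;T⁻¹]) =
      LaurentPolynomial.C y * LaurentPolynomial.T n ↔ x = y := by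
  refine ⟨fun h => ?_, fun h => by rw [h]⟩
  have := congrArg (fun f : R[T;T⁻¹] => f.coeff n) h
  simpa only [coeff_laurentC_mul_T, if_true] using this

theorem expDer_laurentC_mul_T {R : Type*} [CommRing R] (D : R →+ R) (w x : R) (n : ℤ) :
    expDer D w (LaurentPolynomial.C x * LaurentPolynomial.T n) =
      LaurentPolynomial.C (D x + n * w * x) * LaurentPolynomial.T n := by
  refine LaurentPolynomial.ext fun m => ?_
  change D ((LaurentPolynomial.C x * LaurentPolynomial.T n : R[T;T⁻¹]).coeff m) +
    (m : R) * w * (LaurentPolynomial.C x * LaurentPolynomial.T n : R[T;T⁻¹]).coeff m = _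
  rw [coeff_laurentC_mul_T, coeff_laurentC_mul_T]
  split_ifs with h
  · rw [h]
  · simp

theorem eq_of_C_mul_eq {S : Type*} [CommRing S] {q : S} (hq : q ∈ nonZeroDivisors S)
    {f g : LaurentSeries S} (h : HahnSeries.C q * f = HahnSeries.C q * g) : f = g := by
  ext n
  have := congrArg (fun f => HahnSeries.coeff f n) h
  simp only [coeff_C_mul] at this
  exact (mul_cancel_left_mem_nonZeroDivisors hq).1 this

theorem waveMatrix_apply {n : ℤ} (M : Matrix (Fin 2) (Fin 2) (LaurentSeries (TimeRing A)))
    (c : TimeRing A) (x w : LaurentSeries (TimeRing A)) (i : Fin 2) :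
    (ofTime c • ((M.map LaurentPolynomial.C).mulVec
      ![LaurentPolynomial.C x * LaurentPolynomial.T n,
        LaurentPolynomial.C w * LaurentPolynomial.T n])) i =
      (LaurentPolynomial.C (HahnSeries.C c * (M i 0 * x + M i 1 * w)) * LaurentPolynomial.T n :
        WaveRing A) := by
  simp only [Pi.smul_apply, smul_eq_mul, Matrix.mulVec, dotProduct, Fin.sum_univ_two,
    Matrix.map_apply, Matrix.cons_val_zero, Matrix.cons_val_one, ofTime, map_mul, map_add]
  ring

variable [Algebra ℂ A] {δ : Derivation ℂ A A} {q r : TimeRing A} {n : ℤ}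

/-- The first row of `V_0` is `(2ξ, q)`, so the X-equation itself makes the second component the
quotient `(ε ψ_X - ξ ψ) / q`. -/
theorem IsWaveSolution.row {x w : LaurentSeries (TimeRing A)}
    (h : IsWaveSolution (timeDer δ) (eps A) (epsInv A) q r n x w) :
    HahnSeries.C (eps A) * (laurentDer (timeDer δ 0) x +
        (n : LaurentSeries (TimeRing A)) *
          (HahnSeries.C (2 ^ 0 * epsInv A) * xi (TimeRing A) ^ (0 + 1)) * x) -
      xi (TimeRing A) * x = HahnSeries.C q * w := by
  have hinv : (HahnSeries.C (eps A) : LaurentSeries (TimeRing A)) * HahnSeries.C (epsInv A) = 1 := by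
    rw [← map_mul, (isTimeFlow_timeDer δ).inv, map_one]
  rw [(h 0).1]
  simp only [flowW, Matrix.smul_apply, smul_eq_mul, laxV_zero_apply_zero_zero,
    laxV_zero_apply_zero_one, pow_zero, one_mul, zero_add, pow_one]
  linear_combination (xi (TimeRing A) * x + HahnSeries.C q * w) * hinv

theorem satisfiesWaveEquations_iff (hq : q ∈ nonZeroDivisors (TimeRing A))
    (x : LaurentSeries (TimeRing A)) :
    SatisfiesWaveEquations δ q r (LaurentPolynomial.C x * LaurentPolynomial.T n) ↔
      ∃ w, IsWaveSolution (timeDer δ) (eps A) (epsInv A) q r n x w := by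
  have hquot : ofTime (eps A) * waveDer δ 0 (LaurentPolynomial.C x * LaurentPolynomial.T n) -
      waveXi A * (LaurentPolynomial.C x * LaurentPolynomial.T n) =
      LaurentPolynomial.C (HahnSeries.C (eps A) * (laurentDer (timeDer δ 0) x +
        (n : LaurentSeries (TimeRing A)) *
          (HahnSeries.C (2 ^ 0 * epsInv A) * xi (TimeRing A) ^ (0 + 1)) * x) -
      xi (TimeRing A) * x) * LaurentPolynomial.T n := by
    rw [waveDer, expDer_laurentC_mul_T, ofTime, waveXi, map_sub,
      map_mul _ (HahnSeries.C (eps A)), map_mul _ (xi (TimeRing A))]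
    ring
  have hsys : ∀ w : LaurentSeries (TimeRing A),
      (∀ k : ℕ, (fun i => waveDer δ k (![LaurentPolynomial.C x * LaurentPolynomial.T n,
          LaurentPolynomial.C w * LaurentPolynomial.T n] i)) =
        ofTime (2 ^ k * epsInv A) •
        (((timeV δ q r k - (xi (TimeRing A) ^ (k + 1)) •
            (1 : Matrix (Fin 2) (Fin 2) (LaurentSeries (TimeRing A)))).map
          LaurentPolynomial.C).mulVec ![LaurentPolynomial.C x * LaurentPolynomial.T n,
            LaurentPolynomial.C w * LaurentPolynomial.T n])) ↔
      IsWaveSolution (timeDer δ) (eps A) (epsInv A) q r n x w := by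
    intro w
    refine forall_congr' fun k => ?_
    rw [funext_iff, Fin.forall_fin_two]
    refine and_congr ?_ ?_
    · rw [waveMatrix_apply]
      change waveDer δ k (LaurentPolynomial.C x * LaurentPolynomial.T n) = _ ↔ _
      rw [waveDer, expDer_laurentC_mul_T, laurentC_mul_T_inj]
      simp only [timeV, flowW, Matrix.sub_apply, Matrix.smul_apply, smul_eq_mul,
        Matrix.one_apply_eq, Matrix.one_apply_ne (zero_ne_one : (0 : Fin 2) ≠ 1), mul_one,
        mul_zero, sub_zero]
      ring_nf
    · rw [waveMatrix_apply]
      change waveDer δ k (LaurentPolynomial.C w * LaurentPolynomial.T n) = _ ↔ _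
      rw [waveDer, expDer_laurentC_mul_T, laurentC_mul_T_inj]
      simp only [timeV, flowW, Matrix.sub_apply, Matrix.smul_apply, smul_eq_mul,
        Matrix.one_apply_eq, Matrix.one_apply_ne (one_ne_zero : (1 : Fin 2) ≠ 0), mul_one,
        mul_zero, sub_zero]
      ring_nf
  constructor
  · rintro ⟨w, hw, hk⟩
    -- A priori `w` mixes several exponentials; since `q w` involves only `exp (n α)` and `q` is not
    -- a zero divisor, so does `w`.
    have hmono : w = LaurentPolynomial.C (w.coeff n) * LaurentPolynomial.T n := by
      refine LaurentPolynomial.ext fun m => ?_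
      rw [coeff_laurentC_mul_T]
      split_ifs with hm
      · rw [hm]
      · rw [IsQuotient, hquot] at hw
        have := congrArg (fun f : WaveRing A => f.coeff m) hw
        beta_reduce at this
        rw [ofTime, coeff_laurentC_mul_T, if_neg hm, coeff_laurentC_mul] at this
        exact eq_of_C_mul_eq hq (this.trans (mul_zero _).symm)
    rw [hmono] at hk
    exact ⟨_, (hsys _).1 hk⟩
  · rintro ⟨w, hw⟩
    refine ⟨LaurentPolynomial.C w * LaurentPolynomial.T n, ?_, (hsys w).2 hw⟩
    rw [IsQuotient, hquot, hw.row, ofTime, ← mul_assoc, ← map_mul]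

theorem isWavePair_iff (hq : q ∈ nonZeroDivisors (TimeRing A)) (ψA ψB : WaveRing A) :
    IsWavePair δ q r ψA ψB ↔ ∃ (φA φB : PowerSeries (TimeRing A))
      (wA wB : LaurentSeries (TimeRing A)),
      PowerSeries.constantCoeff φA = 1 ∧ PowerSeries.constantCoeff φB = 1 ∧
      ψA = LaurentPolynomial.C (HahnSeries.ofPowerSeries ℤ (TimeRing A) φA) *
        LaurentPolynomial.T 1 ∧
      ψB = LaurentPolynomial.C (HahnSeries.ofPowerSeries ℤ (TimeRing A) φB * HahnSeries.C q) *
        LaurentPolynomial.T (-1) ∧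
      IsWaveSolution (timeDer δ) (eps A) (epsInv A) q r 1
        (HahnSeries.ofPowerSeries ℤ (TimeRing A) φA) wA ∧
      IsWaveSolution (timeDer δ) (eps A) (epsInv A) q r (-1)
        (HahnSeries.ofPowerSeries ℤ (TimeRing A) φB * HahnSeries.C q) wB ∧
      HahnSeries.ofPowerSeries ℤ (TimeRing A) φA * wB -
        wA * (HahnSeries.ofPowerSeries ℤ (TimeRing A) φB * HahnSeries.C q) =
          -2 * xi (TimeRing A) := by
  -- By `IsWaveSolution.row` the Wronskian in `X`, multiplied by `ε`, is `q` times the determinant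
  -- of the two solution vectors; the terms in `ξ` and the exponentials cancel.
  have hpair : ∀ xA wA xB wB : LaurentSeries (TimeRing A),
      IsWaveSolution (timeDer δ) (eps A) (epsInv A) q r 1 xA wA →
      IsWaveSolution (timeDer δ) (eps A) (epsInv A) q r (-1) xB wB →
      (IsQuotient (ofTime (eps A) * (LaurentPolynomial.C xA * LaurentPolynomial.T 1 *
        waveDer δ 0 (LaurentPolynomial.C xB * LaurentPolynomial.T (-1)) -
        waveDer δ 0 (LaurentPolynomial.C xA * LaurentPolynomial.T 1) *
          (LaurentPolynomial.C xB * LaurentPolynomial.T (-1)))) q (-2 * waveXi A) ↔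
        xA * wB - wA * xB = -2 * xi (TimeRing A)) := by
    intro xA wA xB wB hA hB
    have hT : (LaurentPolynomial.T 1 * LaurentPolynomial.T (-1) : WaveRing A) = 1 := by
      rw [← LaurentPolynomial.T_add]
      exact LaurentPolynomial.T_zero
    have e1 : ofTime (eps A) * (LaurentPolynomial.C xA * LaurentPolynomial.T 1 *
        waveDer δ 0 (LaurentPolynomial.C xB * LaurentPolynomial.T (-1)) -
        waveDer δ 0 (LaurentPolynomial.C xA * LaurentPolynomial.T 1) *
          (LaurentPolynomial.C xB * LaurentPolynomial.T (-1))) =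
        LaurentPolynomial.C (HahnSeries.C q * (xA * wB - wA * xB)) * LaurentPolynomial.T 0 := by
      have : HahnSeries.C q * (xA * wB - wA * xB) =
          xA * (HahnSeries.C q * wB) - (HahnSeries.C q * wA) * xB := by ring
      rw [this, ← hA.row, ← hB.row, waveDer, expDer_laurentC_mul_T, expDer_laurentC_mul_T, ofTime,
        LaurentPolynomial.T_zero]
      generalize laurentDer (timeDer δ 0) xA + _ = dA
      generalize laurentDer (timeDer δ 0) xB + _ = dB
      simp only [map_sub, map_mul]
      linear_combination LaurentPolynomial.C (HahnSeries.C (eps A)) *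
        (LaurentPolynomial.C xA * LaurentPolynomial.C dB -
          LaurentPolynomial.C dA * LaurentPolynomial.C xB) * hT
    have e2 : ofTime q * (-2 * waveXi A) = LaurentPolynomial.C
        (HahnSeries.C q * (-2 * xi (TimeRing A))) * LaurentPolynomial.T 0 := by
      rw [LaurentPolynomial.T_zero, mul_one, ofTime, waveXi]
      simp only [map_mul, map_neg, map_ofNat]
    rw [IsQuotient, e1, e2, laurentC_mul_T_inj]
    exact ⟨fun h => (eq_of_C_mul_eq hq h).symm, fun h => by rw [h]⟩
  have hBform : ∀ φ : PowerSeries (TimeRing A),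
      ofSeries φ * ofTime q * LaurentPolynomial.T (-1) = LaurentPolynomial.C
        (HahnSeries.ofPowerSeries ℤ (TimeRing A) φ * HahnSeries.C q) *
        LaurentPolynomial.T (-1) := by
    intro φ
    rw [ofSeries, ofTime, ← map_mul]
  constructor
  · rintro ⟨⟨⟨φA, hA0, hA⟩, hA'⟩, ⟨⟨φB, hB0, hB⟩, hB'⟩, hp⟩
    rw [hBform] at hB
    rw [ofSeries] at hA
    subst hA hB
    obtain ⟨wA, hwA⟩ := (satisfiesWaveEquations_iff hq _).1 hA'
    obtain ⟨wB, hwB⟩ := (satisfiesWaveEquations_iff hq _).1 hB'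
    exact ⟨φA, φB, wA, wB, hA0, hB0, rfl, rfl, hwA, hwB, (hpair _ _ _ _ hwA hwB).1 hp⟩
  · rintro ⟨φA, φB, wA, wB, hA0, hB0, rfl, rfl, hwA, hwB, hd⟩
    exact ⟨⟨⟨φA, hA0, rfl⟩, (satisfiesWaveEquations_iff hq _).2 ⟨wA, hwA⟩⟩,
      ⟨⟨φB, hB0, (hBform φB).symm⟩, (satisfiesWaveEquations_iff hq _).2 ⟨wB, hwB⟩⟩,
      (hpair _ _ _ _ hwA hwB).2 hd⟩

theorem ofConst_eq (G : PowerSeries (LaurentSeries ℂ)) :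
    ofConst A G = LaurentPolynomial.C
      (HahnSeries.ofPowerSeries ℤ (TimeRing A) (PowerSeries.map (constHom A) G)) := by
  rw [ofConst, ofSeries]
  congr 2
  ext1 j
  rw [PowerSeries.coeff_mk, PowerSeries.coeff_map, constHom_apply]

theorem laurentDer_map_constHom (k : ℕ) (G : PowerSeries (LaurentSeries ℂ)) :
    laurentDer (timeDer δ k)
      (HahnSeries.ofPowerSeries ℤ (TimeRing A) (PowerSeries.map (constHom A) G)) = 0 := by
  ext n : 2
  rw [laurentDer_coeff, PowerSeries.coeff_coe]
  split_ifs
  · exact map_zero _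
  · rw [PowerSeries.coeff_map, timeDer_constHom, HahnSeries.coeff_zero]

theorem exists_inverse_of_constantCoeff_eq_one {S : Type*} [CommRing S] {φ : PowerSeries S}
    (hφ : PowerSeries.constantCoeff φ = 1) :
    ∃ ψ, PowerSeries.constantCoeff ψ = 1 ∧ φ * ψ = 1 := by
  obtain ⟨ψ, hψ⟩ := (PowerSeries.isUnit_iff_constantCoeff.2 (hφ ▸ isUnit_one)).dvd (a := 1)
  refine ⟨ψ, ?_, hψ.symm⟩
  have := congrArg PowerSeries.constantCoeff hψ
  rw [map_mul, hφ, one_mul, map_one] at this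
  exact this.symm

/-! ### Existence of a pair and the freedom in choosing it. -/

theorem exists_isWavePair (V : Subalgebra ℂ A) (hVδ : ∀ a ∈ V, δ a ∈ V)
    (hV : ∀ a ∈ V, ∃ b : A, δ b = a)
    (hqV : ∀ m n, (MvPowerSeries.coeff m q).coeff n ∈ V)
    (hrV : ∀ m n, (MvPowerSeries.coeff m r).coeff n ∈ V)
    (hsol : IsAKNSSolution δ q r) (hq : q ∈ nonZeroDivisors (TimeRing A))
    (hqX : q ∣ timeDer δ 0 q) : ∃ ψA ψB : WaveRing A, IsWavePair δ q r ψA ψB := by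
  have h := isTimeFlow_timeDer δ
  have hmem := resCoeff_mem (timeSubalgebra V) (timeDer δ 0)
    (fun x hx m n => hVδ _ (hx m n)) (C_single_mem_timeSubalgebra V 1)
    (show q ∈ timeSubalgebra V from hqV) (show r ∈ timeSubalgebra V from hrV)
  obtain ⟨s, hsV, hs⟩ := exists_tailSeries_div (timeSubalgebra V) _ _ (fun j => (hmem j).1)
    (fun j => (hmem j).2.2)
  have hy : resolvent (timeDer δ 0) (eps A) q r 0 0 * tailSeries s =
      resolvent (timeDer δ 0) (eps A) q r 1 0 := hs
  choose ω hω using fun k => exists_eq_tailSeries _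
    ((plusPart_eq_zero_iff _).2 (logDer_mem_minus h hy (tailSeries_mem_minus s) k))
  have hclosed : ∀ i j k, timeDer δ j (ω k i) = timeDer δ k (ω j i) := by
    intro i j k
    have h1 : laurentDer (timeDer δ j) (tailSeries (ω k)) =
        laurentDer (timeDer δ k) (tailSeries (ω j)) := by
      have h2 : ∀ j k, laurentDer (timeDer δ j)
          (2 * (HahnSeries.C (2 ^ k * epsInv A) * xi (TimeRing A) ^ (k + 1))) = 0 := by
        intro j k
        rw [h.laurent_leibniz, h.laurentDer_two, h.laurentDer_scale_mul_xi_pow, mul_zero, mul_zero,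
          add_zero]
      rw [← hω, ← hω, map_sub, map_sub, h2, h2, logDer_closed h hsol hy]
    rw [laurentDer_tailSeries, laurentDer_tailSeries] at h1
    exact congrFun (tailSeries_injective h1) i
  have hω0 : ∀ i, ω 0 i ∈ timeSubalgebra V := by
    intro i
    have h1 := (hω 0).symm.trans logDer_zero_eq
    rw [C_mul_tailSeries] at h1
    rw [tailSeries_injective h1]
    exact mul_mem (mul_mem (C_single_mem_timeSubalgebra V (-1)) hqV) (hsV i)
  -- Each power of `ξ⁻¹` is integrated separately; the primitive in `X` at zero times exists because
  -- the X-component has coefficients in `V`.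
  choose σ hσ using fun i => exists_potential δ (fun k => ω k i) (hclosed i)
    (fun n => hV _ (hω0 i 0 n))
  obtain ⟨φ, hφ0, hφ⟩ := exists_exp σ
  have hφ' : ∀ k, laurentDer (timeDer δ k) (HahnSeries.ofPowerSeries ℤ (TimeRing A) φ) = _ :=
    fun k => by rw [hφ _ (h.leibniz k), funext fun i => hσ i k, ← hω k]
  obtain ⟨φ', hφ0', hinv⟩ := exists_inverse_of_constantCoeff_eq_one hφ0
  have hinv' := congrArg (HahnSeries.ofPowerSeries ℤ (TimeRing A)) hinv
  rw [map_mul, map_one] at hinv'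
  obtain ⟨f, hf0, hf⟩ := exists_xi_mul_resolvent (timeDer δ 0) (h.leibniz 0) (eps A) q r hqX
  have hB := isWaveSolution_second h hsol hy hφ' hinv'
  have hd := det_of_ratio h hy hinv'
  rw [hf, ← mul_assoc, ← map_mul] at hB
  rw [hf, ← mul_assoc (HahnSeries.ofPowerSeries ℤ _ φ') (HahnSeries.ofPowerSeries ℤ _ f),
    ← map_mul _ φ' f] at hd
  exact ⟨_, _, (isWavePair_iff hq _ _).2 ⟨φ, φ' * f, _, _, hφ0, by rw [map_mul, hφ0', hf0, one_mul],
    rfl, rfl, isWaveSolution_first h hsol hy hφ', hB, hd⟩⟩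

theorem IsWavePair.const_mul (hq : q ∈ nonZeroDivisors (TimeRing A)) {ψA ψB : WaveRing A}
    (hp : IsWavePair δ q r ψA ψB) {G : PowerSeries (LaurentSeries ℂ)}
    (hG : PowerSeries.constantCoeff G = 1) :
    IsWavePair δ q r (ofConst A G * ψA) (ofConst A G⁻¹ * ψB) := by
  have h := isTimeFlow_timeDer δ
  obtain ⟨φA, φB, wA, wB, hA0, hB0, rfl, rfl, hA, hB, hd⟩ := (isWavePair_iff hq _ _).1 hp
  have hG' : PowerSeries.constantCoeff G⁻¹ = 1 := by
    rw [PowerSeries.constantCoeff_inv, hG, inv_one]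
  have hGG : HahnSeries.ofPowerSeries ℤ (TimeRing A) (PowerSeries.map (constHom A) G) *
      HahnSeries.ofPowerSeries ℤ (TimeRing A) (PowerSeries.map (constHom A) G⁻¹) = 1 := by
    rw [← map_mul, ← map_mul, PowerSeries.mul_inv_cancel G (by rw [hG]; exact one_ne_zero), map_one,
      map_one]
  have hc : ∀ G : PowerSeries (LaurentSeries ℂ), PowerSeries.constantCoeff G = 1 →
      PowerSeries.constantCoeff (PowerSeries.map (constHom A) G) = 1 := by
    intro G hG
    rw [← PowerSeries.coeff_zero_eq_constantCoeff_apply, PowerSeries.coeff_map,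
      PowerSeries.coeff_zero_eq_constantCoeff_apply, hG, map_one]
  have hA' := hA.const_mul h (fun k => laurentDer_map_constHom k G)
  have hB' := hB.const_mul h (fun k => laurentDer_map_constHom k G⁻¹)
  rw [← map_mul] at hA'
  rw [← mul_assoc, ← map_mul] at hB'
  refine (isWavePair_iff hq _ _).2 ⟨PowerSeries.map (constHom A) G * φA,
    PowerSeries.map (constHom A) G⁻¹ * φB, _, _, by rw [map_mul, hc G hG, hA0, one_mul],
    by rw [map_mul, hc _ hG', hB0, one_mul], ?_, ?_, hA', hB', ?_⟩
  · rw [ofConst_eq, ← mul_assoc, ← map_mul, ← map_mul]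
  · rw [ofConst_eq, ← mul_assoc, ← map_mul, ← mul_assoc, ← map_mul]
  · rw [map_mul, map_mul]
    linear_combination HahnSeries.ofPowerSeries ℤ (TimeRing A) (PowerSeries.map (constHom A) G) *
      HahnSeries.ofPowerSeries ℤ (TimeRing A) (PowerSeries.map (constHom A) G⁻¹) * hd -
      2 * xi (TimeRing A) * hGG

theorem IsWavePair.exists_const (hconst : ∀ a : A, δ a = 0 → a ∈ (algebraMap ℂ A).range)
    (hq : q ∈ nonZeroDivisors (TimeRing A)) {ψA ψB ψA' ψB' : WaveRing A}
    (hp : IsWavePair δ q r ψA ψB) (hp' : IsWavePair δ q r ψA' ψB') :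
    ∃ G : PowerSeries (LaurentSeries ℂ), PowerSeries.constantCoeff G = 1 ∧
      ψA' = ofConst A G * ψA ∧ ψB' = ofConst A G⁻¹ * ψB := by
  have h := isTimeFlow_timeDer δ
  obtain ⟨φA, φB, wA, wB, hA0, hB0, rfl, rfl, hA, hB, hd⟩ := (isWavePair_iff hq _ _).1 hp
  obtain ⟨φA', φB', wA', wB', hA0', hB0', rfl, rfl, hA', hB', hd'⟩ := (isWavePair_iff hq _ _).1 hp'
  obtain ⟨g, g', hg, hgg, e1, e2⟩ := exists_const_of_det h hA hB hd hA' hB' hd'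
  obtain ⟨θ, hθ0, hθ⟩ := exists_inverse_of_constantCoeff_eq_one hA0
  -- As a quotient of two normalised series, `g` has no positive powers of `ξ` and leading
  -- coefficient 1.
  have hgθ : g = HahnSeries.ofPowerSeries ℤ (TimeRing A) (φA' * θ) := by
    have := congrArg (HahnSeries.ofPowerSeries ℤ (TimeRing A)) hθ
    rw [map_mul, map_one] at this
    rw [map_mul, e1]
    linear_combination -g * this
  have hcoeff : ∀ j, ∃ c, PowerSeries.coeff j (φA' * θ) = constHom A c := by
    intro j
    refine exists_eq_constHom δ hconst _ fun k => ?_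
    have := congrArg (fun f => HahnSeries.coeff f (j : ℤ)) (hg k)
    beta_reduce at this
    rw [hgθ, laurentDer_coeff, HahnSeries.ofPowerSeries_apply_coeff] at this
    exact this
  choose c hc using hcoeff
  -- The chosen `c 0` is only known to map to 1 under `constHom`, so the zeroth coefficient is
  -- replaced by 1 itself.
  obtain ⟨G, hGdef⟩ : ∃ G : PowerSeries (LaurentSeries ℂ),
      G = PowerSeries.mk fun j => Nat.casesOn j 1 fun i => c (i + 1) := ⟨_, rfl⟩
  have hG : PowerSeries.constantCoeff G = 1 := by simp [hGdef]
  have hmap : PowerSeries.map (constHom A) G = φA' * θ := by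
    ext1 j
    rw [PowerSeries.coeff_map, hGdef, PowerSeries.coeff_mk]
    cases j with
    | zero =>
      rw [PowerSeries.coeff_zero_eq_constantCoeff_apply, map_mul, hA0', hθ0, one_mul]
      exact map_one _
    | succ j => exact (hc _).symm
  have hGG : g * HahnSeries.ofPowerSeries ℤ (TimeRing A) (PowerSeries.map (constHom A) G⁻¹) =
      1 := by
    rw [hgθ, ← hmap, ← map_mul, ← map_mul,
      PowerSeries.mul_inv_cancel G (by rw [hG]; exact one_ne_zero), map_one, map_one]
  have hg' : g' = HahnSeries.ofPowerSeries ℤ (TimeRing A) (PowerSeries.map (constHom A) G⁻¹) := by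
    linear_combination HahnSeries.ofPowerSeries ℤ (TimeRing A)
      (PowerSeries.map (constHom A) G⁻¹) * hgg - g' * hGG
  refine ⟨G, hG, ?_, ?_⟩
  · rw [ofConst_eq, hmap, ← hgθ, e1, map_mul, mul_assoc]
  · rw [ofConst_eq, ← hg', e2, map_mul, mul_assoc]

end WaveRing

end AKNS

theorem lemma3p3 {A : Type*} [CommRing A] [Algebra ℂ A] (δ : Derivation ℂ A A)
    (hconst : ∀ a : A, δ a = 0 → a ∈ (algebraMap ℂ A).range)
    (V : Subalgebra ℂ A) (hVδ : ∀ a ∈ V, δ a ∈ V) (hV : ∀ a ∈ V, ∃ b : A, δ b = a)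
    (q r : AKNS.TimeRing A)
    (hqV : ∀ m n, (MvPowerSeries.coeff m q).coeff n ∈ V)
    (hrV : ∀ m n, (MvPowerSeries.coeff m r).coeff n ∈ V)
    (hsol : AKNS.IsAKNSSolution δ q r)
    (hq : q ∈ nonZeroDivisors (AKNS.TimeRing A)) (hqX : q ∣ AKNS.timeDer δ 0 q) :
    (∃ ψA ψB : AKNS.WaveRing A, AKNS.IsWavePair δ q r ψA ψB) ∧
    ∀ ψA ψB : AKNS.WaveRing A, AKNS.IsWavePair δ q r ψA ψB →
      ∀ ψA' ψB' : AKNS.WaveRing A, AKNS.IsWavePair δ q r ψA' ψB' ↔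
        ∃ G : PowerSeries (LaurentSeries ℂ), PowerSeries.constantCoeff G = 1 ∧
          ψA' = AKNS.ofConst A G * ψA ∧ ψB' = AKNS.ofConst A G⁻¹ * ψB := by
  refine ⟨AKNS.exists_isWavePair V hVδ hV hqV hrV hsol hq hqX, fun ψA ψB hp ψA' ψB' =>
    ⟨fun hp' => hp.exists_const hconst hq hp', ?_⟩⟩
  rintro ⟨G, hG, rfl, rfl⟩
  exact hp.const_mul hq hG
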